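/- Let $q>2$, $0<h<1$ with $2/h\notin\mathbb Z$, put $\ell^*=\lceil 2/h\rceil$, and let $K,L\ge 3\ell^*$. Let $\Lambda=(V,E)$ be the $K\times L$ grid with periodic boundary conditions, $\mathcal X=\{1,\dots,q\}^V$, and $$H(\sigma)=-\sum_{(v,w)\in E}\mathbb 1_{\{\sigma(v)=\sigma(w)\}}+h\sum_{u\in V}\mathbb 1_{\{\sigma(u)=1\}},\qquad \sigma\in\mathcal X,$$ (the $q$-state Potts model with negative external magnetic field). Let $\mathbf 1\in\mathcal X$ be the configuration with all spins equal to $1$, and let $\mathcal X^s\subset\mathcal X$ be the set of stable states, that is, of global minima of $H$. A path is a finite sequence $\omega=(\omega_0,\dots,\omega_n)$ in $\mathcal X$ in which consecutive configurations differ in exactly one spin; its height is $\max_i H(\omega_i)$. For $\sigma\in\mathcal X$ and a non-empty $\mathcal A\subseteq\mathcal X$, a path from $\sigma$ to (an element of) $\mathcal A$ is optimal if its height equals the minimum $\Phi(\sigma,\mathcal A)$ of the heights of all such paths, and $\mathcal S(\sigma,\mathcal A)$ denotes the set of the configurations of energy $\Phi(\sigma,\mathcal A)$ that lie on some optimal path.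 A gate for the transition $\sigma\to\mathcal A$ is a set $\mathcal W\subseteq\mathcal S(\sigma,\mathcal A)$ that is visited by every optimal path from $\sigma$ to $\mathcal A$; a gate is minimal if each of its proper subsets is avoided by some optimal path. $\mathcal G(\sigma,\mathcal A)$ denotes the union of all minimal gates for $\sigma\to\mathcal A$. For a single target state $\eta$ we write $\sigma\to\eta$ and $\mathcal G(\sigma,\eta)$, meaning $\mathcal A=\{\eta\}$. Finally, let $\mathcal W(\mathbf 1,\mathcal X^s)$ be the set of all configurations in which, for some $t\in\{2,\dots,q\}$, all spins are $1$ except those, which are $t$, in a rectangle with side lengths $\ell^*-1$ and $\ell^*$ (in either orientation) together with one unit square attached to one of its sides of length $\ell^*$. Then, for every $\mathbf s\in\mathcal X^s$, the set $\mathcal W(\mathbf 1,\mathcal X^s)$ is a minimal gate for the transition $\mathbf 1\to\mathbf s$, and $$\mathcal G(\mathbf 1,\mathbf s)=\mathcal G(\mathbf 1,\mathcal X^s).$$ -/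

import Mathlib

/-! ### Energy landscapes -/

namespace EnergyLandscape

noncomputable section

variable {X : Type*}

/-- A path is a finite sequence `ω₀, …, ωₙ` with `Q(ωᵢ, ωᵢ₊₁) > 0` for all `i < n`. -/
abbrev Path (Q : X → X → ℝ) : Type _ := RelSeries {p : X × X | 0 < Q p.1 p.2}

/-- The height of a path: the maximal energy along it. -/
def height (H : X → ℝ) {Q : X → X → ℝ} (ω : Path Q) : ℝ :=
  Finset.univ.sup' Finset.univ_nonempty fun i : Fin (ω.length + 1) => H (ω i)

/-- The paths that start in `σ` and end in the target set `A`. -/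
def paths (Q : X → X → ℝ) (σ : X) (A : Set X) : Set (Path Q) :=
  {ω | ω.head = σ ∧ ω.last ∈ A}

/-- The communication height `Φ(σ, A)`: the minimal height of a path from `σ` to `A`
(for a single target state take `A = {σ'}`). -/
def commHeight (H : X → ℝ) (Q : X → X → ℝ) (σ : X) (A : Set X) : ℝ :=
  sInf (height H '' paths Q σ A)

/-- The optimal paths from `σ` to `A`. -/
def optPaths (H : X → ℝ) (Q : X → X → ℝ) (σ : X) (A : Set X) : Set (Path Q) :=
  {ω | ω ∈ paths Q σ A ∧ height H ω = commHeight H Q σ A}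

/-- The minimal saddles between `σ` and `A`. -/
def minimalSaddles (H : X → ℝ) (Q : X → X → ℝ) (σ : X) (A : Set X) : Set X :=
  {ξ | ∃ ω ∈ optPaths H Q σ A, ξ ∈ ω ∧ height H ω = H ξ}

/-- `W` is a gate for the transition from `σ` to `A`. -/
def IsGate (H : X → ℝ) (Q : X → X → ℝ) (σ : X) (A : Set X) (W : Set X) : Prop :=
  W ⊆ minimalSaddles H Q σ A ∧ ∀ ω ∈ optPaths H Q σ A, ∃ η ∈ W, η ∈ ω

/-- `W` is a minimal gate: a gate such that every proper subset is missed by some optimal path. -/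
def IsMinimalGate (H : X → ℝ) (Q : X → X → ℝ) (σ : X) (A : Set X) (W : Set X) : Prop :=
  IsGate H Q σ A W ∧ ∀ W', W' ⊂ W → ∃ ω ∈ optPaths H Q σ A, ∀ η ∈ W', η ∉ ω

/-- The union of all minimal gates for the transition from `σ` to `A`. -/
def gateUnion (H : X → ℝ) (Q : X → X → ℝ) (σ : X) (A : Set X) : Set X :=
  ⋃₀ {W | IsMinimalGate H Q σ A W}

/-- The stable states: the global minima of the energy. -/
def stableStates (H : X → ℝ) : Set X := {σ | ∀ η, H σ ≤ H η}

end

end EnergyLandscape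

/-! ### The Potts model on the `K × L` torus -/

namespace Potts

noncomputable section

/-- The spin values `1, …, q`. -/
abbrev Spin (q : ℕ) : Type := ↥(Finset.Icc 1 q)

/-- The spin value `1`. -/
def spinOne (q : ℕ) [NeZero q] : Spin q :=
  ⟨1, Finset.mem_Icc.2 ⟨le_rfl, Nat.one_le_iff_ne_zero.2 (NeZero.ne q)⟩⟩

/-- The vertices of the `K × L` grid with periodic boundary conditions. -/
abbrev Vertex (K L : ℕ) : Type := ZMod K × ZMod L

/-- Spin configurations. -/
abbrev Config (K L q : ℕ) : Type := Vertex K L → Spin q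

variable {K L q : ℕ}

/-- The configuration in which all the spins are equal to `1`. -/
def allOne (K L q : ℕ) [NeZero q] : Config K L q := fun _ => spinOne q

/-- The edges of the torus: every vertex is joined to the next one in its column and in its row. -/
def edges (K L : ℕ) [NeZero K] [NeZero L] : Finset (Sym2 (Vertex K L)) :=
  Finset.univ.image (fun v : Vertex K L => s(v, v + (1, 0))) ∪
    Finset.univ.image (fun v : Vertex K L => s(v, v + (0, 1)))

/-- The Hamiltonian with coupling constant `1` and negative external field `-h` on the spin `1`.
An edge `{v, w}` is mapped to the diagonal by `σ` exactly if `σ v = σ w`. -/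
def energy [NeZero K] [NeZero L] (h : ℝ) (σ : Config K L q) : ℝ :=
  -(∑ e ∈ edges K L, if (e.map σ).IsDiag then (1 : ℝ) else 0) +
    h * ∑ u : Vertex K L, if (σ u : ℕ) = 1 then (1 : ℝ) else 0

/-- The connectivity matrix of the single spin-flip dynamics. -/
def connectivity [NeZero K] [NeZero L] (σ σ' : Config K L q) : ℝ :=
  if hammingDist σ σ' = 1 then 1 / ((q : ℝ) * Fintype.card (Vertex K L)) else 0

/-- The rectangle on the torus with corner `v₀` and with `m` rows and `n` columns. -/
def rectangle (v₀ : Vertex K L) (m n : ℕ) : Set (Vertex K L) :=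
  {v | (v.1 - v₀.1).val < m ∧ (v.2 - v₀.2).val < n}

/-- The regions that consist of a rectangle `a × b` (in either orientation) and a bar `1 × l`
adjacent to one of its sides of length `b`; the four cases are the four possible sides, and `c` is
the position of the bar along the side. -/
def rectanglesWithBar (K L a b l : ℕ) : Set (Set (Vertex K L)) :=
  {R | ∃ (v₀ : Vertex K L) (c : ℕ), c + l ≤ b ∧
    (R = rectangle v₀ a b ∪ rectangle (v₀ + ((a : ZMod K), (c : ZMod L))) 1 l ∨
     R = rectangle v₀ a b ∪ rectangle (v₀ + ((-1 : ZMod K), (c : ZMod L))) 1 l ∨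
     R = rectangle v₀ b a ∪ rectangle (v₀ + ((c : ZMod K), (a : ZMod L))) l 1 ∨
     R = rectangle v₀ b a ∪ rectangle (v₀ + ((c : ZMod K), (-1 : ZMod L))) l 1)}

/-- The configurations in which all the spins are `r`, except those, which are `s`, in a rectangle
`a × b` with a bar `1 × l` adjacent to one of the sides of length `b`. -/
def barB (a b l : ℕ) (r s : Spin q) : Set (Config K L q) :=
  {σ | ∃ R ∈ rectanglesWithBar K L a b l, ∀ v, (v ∈ R → σ v = s) ∧ (v ∉ R → σ v = r)}

/-- The critical length `⌈2 / h⌉`. -/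
def criticalLength (h : ℝ) : ℕ := ⌈2 / h⌉₊

/-- The configurations with all spins `1`, except those, which are equal to some `t ≠ 1`, in a
quasi-square with a unit protuberance on one of its longest sides. -/
def criticalSet (K L q : ℕ) [NeZero q] (h : ℝ) : Set (Config K L q) :=
  ⋃ t ∈ {t : Spin q | t ≠ spinOne q},
    barB (criticalLength h - 1) (criticalLength h) 1 (spinOne q) t

end

end Potts

/-! Let `k + 1 = ⌈2 / h⌉`. Up to a constant, the energy is the number of disagreeing edges minus `h`
times the number of vertices with spin other than `1` (`energy_eq`). The disagreeing edges are the
boundary of this vertex set and the edges between different spins inside it (`wall_eq`). Let `Γ` be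
the energy of a `k × (k + 1)` rectangle with one vertex attached to a long side (`saddleEnergy`).

By `isMinimalGate_and_gateUnion_eq` two facts suffice: every path of height at most `Γ` from `1` to
a stable state meets the critical set, and each critical configuration is the only state of energy
at least `Γ` on some path to `s`. They make the critical set the unique minimal gate, both for the
target `s` and for the set of all stable states.

For the first fact (`visits_criticalSet`), count the rows and the columns that the non-`1` set
meets. If area and perimeter are moderate, no line is full, so half the perimeter is at least the
sum of the two numbers, while the area is at most their product. For areas between `k * (k + 1) + 1`
and `(k + 1) ^ 2`, energy at most `Γ` forces the sum to be `2 * (k + 1)`; both numbers are monotone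
under inclusion, so moves inside this range change neither. Area `(k + 1) ^ 2` requires both to be
`k + 1`, and this shape can only be acquired when the area passes from `k * (k + 1)` to `k * (k + 1)
+ 1`. At that move a full `k × (k + 1)` rectangle becomes a critical droplet, and the energy bound
excludes different spins inside it.

For the second fact (`exists_path_through`), the droplet is built bar by bar: `h * k < 2` keeps the
energy below `Γ` before the critical vertex, `2 < h * (k + 1)` after it. If the torus ends up filled
with the wrong spin, a droplet of the right one is grown inside; the field is then indifferent, and
the size of the torus keeps the energy below `Γ`. -/

namespace EnergyLandscape

/-! ### Gates in an abstract energy landscape -/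

variable {X : Type*}

theorem height_le_iff {H : X → ℝ} {Q : X → X → ℝ} {ω : Path Q} {a : ℝ} :
    height H ω ≤ a ↔ ∀ x ∈ ω, H x ≤ a := by
  unfold height
  rw [Finset.sup'_le_iff]
  constructor
  · rintro h x ⟨i, rfl⟩
    exact h i (Finset.mem_univ _)
  · exact fun h i _ => h _ ⟨i, rfl⟩

theorem le_height {H : X → ℝ} {Q : X → X → ℝ} {ω : Path Q} {x : X} (hx : x ∈ ω) :
    H x ≤ height H ω :=
  height_le_iff.1 le_rfl x hx

/-- A path can be prolonged along a chain of allowed moves between states satisfying `P`. -/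
theorem exists_path_extension {Q : X → X → ℝ} {P : X → Prop} (ω : Path Q) {b : X}
    (h : Relation.ReflTransGen (fun x y => 0 < Q x y ∧ P y) ω.last b) :
    ∃ ω' : Path Q, ω'.head = ω.head ∧ ω'.last = b ∧ (∀ x ∈ ω, x ∈ ω') ∧
      ∀ x ∈ ω', x ∈ ω ∨ P x := by
  induction h with
  | refl => exact ⟨ω, rfl, rfl, fun _ => id, fun _ => Or.inl⟩
  | @tail b c _ hbc ih =>
    obtain ⟨ω', h1, h2, h3, h4⟩ := ih
    have hr : (ω'.last, c) ∈ {p : X × X | 0 < Q p.1 p.2} := by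
      rw [h2]; exact hbc.1
    refine ⟨ω'.snoc c hr, by simpa using h1, by simp, fun x hx => ?_, fun x hx => ?_⟩
    · exact RelSeries.mem_snoc.2 (Or.inl (h3 x hx))
    · rcases RelSeries.mem_snoc.1 hx with hx | rfl
      · exact h4 x hx
      · exact Or.inr hbc.2

/-- If every path from `σ` to `A` of height at most `Γ` visits `W`, and every `w ∈ W` is the only
state of energy at least `Γ` on some path from `σ` to `A`, then `W` is a minimal gate, and the
only one. -/
theorem isMinimalGate_and_gateUnion_eq {H : X → ℝ} {Q : X → X → ℝ} {σ : X} {A W : Set X} {Γ : ℝ}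
    (hne : W.Nonempty)
    (hvisit : ∀ ω ∈ paths Q σ A, height H ω ≤ Γ → ∃ η ∈ W, η ∈ ω)
    (henergy : ∀ w ∈ W, H w = Γ)
    (hpath : ∀ w ∈ W, ∃ ω ∈ paths Q σ A, w ∈ ω ∧ ∀ x ∈ ω, x ≠ w → H x < Γ) :
    IsMinimalGate H Q σ A W ∧ gateUnion H Q σ A = W := by
  have hlow : ∀ ω ∈ paths Q σ A, Γ ≤ height H ω := by
    intro ω hω
    by_contra! hlt
    obtain ⟨η, hη, hηω⟩ := hvisit ω hω hlt.le
    linarith [henergy η hη, le_height (H := H) hηω]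
  have hheight : ∀ w ∈ W, ∀ ω ∈ paths Q σ A, w ∈ ω → (∀ x ∈ ω, x ≠ w → H x < Γ) →
      height H ω = Γ := by
    intro w hw ω hω _ hlt
    refine le_antisymm (height_le_iff.2 fun x hx => ?_) (hlow ω hω)
    by_cases hxw : x = w
    · rw [hxw, henergy w hw]
    · exact (hlt x hx hxw).le
  have hcomm : commHeight H Q σ A = Γ := by
    obtain ⟨w, hw⟩ := hne
    obtain ⟨ω, hω, hwω, hlt⟩ := hpath w hw
    refine le_antisymm ?_ ?_
    · refine csInf_le ⟨Γ, ?_⟩ ⟨ω, hω, hheight w hw ω hω hwω hlt⟩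
      rintro _ ⟨ω', hω', rfl⟩
      exact hlow ω' hω'
    · refine le_csInf ⟨_, ω, hω, rfl⟩ ?_
      rintro _ ⟨ω', hω', rfl⟩
      exact hlow ω' hω'
  have hopt : ∀ w ∈ W, ∃ ω ∈ optPaths H Q σ A, w ∈ ω ∧ ∀ x ∈ ω, x ≠ w → H x < Γ := by
    intro w hw
    obtain ⟨ω, hω, hwω, hlt⟩ := hpath w hw
    exact ⟨ω, ⟨hω, by rw [hcomm, hheight w hw ω hω hwω hlt]⟩, hwω, hlt⟩
  have hgate : IsGate H Q σ A W := by
    refine ⟨fun w hw => ?_, fun ω hω => hvisit ω hω.1 (by rw [hω.2, hcomm])⟩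
    obtain ⟨ω, hω, hwω, -⟩ := hopt w hw
    exact ⟨ω, hω, hwω, by rw [hω.2, hcomm, henergy w hw]⟩
  -- The path through `w` meets `W'`, whose elements, as minimal saddles, have energy `Γ`; on this
  -- path only `w` has that energy.
  have hsub : ∀ W', IsGate H Q σ A W' → W ⊆ W' := by
    intro W' hW' w hw
    obtain ⟨ω, hω, hwω, hlt⟩ := hopt w hw
    obtain ⟨η, hη, hηω⟩ := hW'.2 ω hω
    by_cases hηw : η = w
    · rwa [← hηw]
    · obtain ⟨ω', hω', -, hη'⟩ := hW'.1 hη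
      have := hlt η hηω hηw
      rw [hω'.2, hcomm] at hη'
      linarith
  have hmin : IsMinimalGate H Q σ A W := by
    refine ⟨hgate, fun W' hW' => ?_⟩
    obtain ⟨w, hw, hwW'⟩ := Set.exists_of_ssubset hW'
    obtain ⟨ω, hω, -, hlt⟩ := hopt w hw
    refine ⟨ω, hω, fun η hη hηω => ?_⟩
    have hηw : η ≠ w := fun h => hwW' (h ▸ hη)
    linarith [hlt η hηω hηw, henergy η (hW'.1 hη)]
  refine ⟨hmin, Set.Subset.antisymm ?_ (Set.subset_sUnion_of_mem hmin)⟩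
  refine Set.sUnion_subset fun W' hW' => ?_
  by_contra hnot
  obtain ⟨ω, hω, hmiss⟩ := hW'.2 W ⟨hsub W' hW'.1, hnot⟩
  obtain ⟨η, hη, hηω⟩ := hgate.2 ω hω
  exact hmiss η hη hηω

/-- A path that starts in `B` and leaves it has to visit `W`, if `W` is on every move out of
`B`. -/
theorem exists_mem_of_leaves {Q : X → X → ℝ} {B W : Set X} {ω : Path Q}
    (hstep : ∀ x ∈ ω, ∀ y ∈ ω, x ∈ B → 0 < Q x y → y ∉ W → y ∈ B)
    (hhead : ω.head ∈ B) (hlast : ω.last ∉ B) : ∃ η ∈ W, η ∈ ω := by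
  by_contra! hW
  have hall : ∀ n : ℕ, ∀ hn : n < ω.length + 1, ω ⟨n, hn⟩ ∈ B := by
    intro n
    induction n with
    | zero => exact fun _ => hhead
    | succ n ih =>
      intro hn
      exact hstep _ ⟨_, rfl⟩ _ ⟨_, rfl⟩ (ih (by omega)) (ω.step ⟨n, by omega⟩)
        fun h => hW _ h ⟨_, rfl⟩
  exact hlast (hall ω.length (by omega))

end EnergyLandscape

/-! ### Disagreements along a direction in a finite group -/

section Disagreement

variable {G T : Type*} [AddCommGroup G] [DecidableEq G] [DecidableEq T]

/-- The number of the points `w` at which `f` changes its value in the direction `e`. -/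
def disagreements [Fintype G] (e : G) (f : G → T) : ℕ :=
  (Finset.univ.filter fun w => f w ≠ f (w + e)).card

/-- The points of `A` from which a step in the direction `e` leads out of `A`. -/
def exits (e : G) (A : Finset G) : Finset G := A.filter fun w => w + e ∉ A

theorem mem_exits {e w : G} {A : Finset G} : w ∈ exits e A ↔ w ∈ A ∧ w + e ∉ A :=
  Finset.mem_filter

/-- Translation by `e` is a bijection, so as many points are moved into `A` as lie in `A`;
discarding the points that do both leaves the entrances and the exits. -/
theorem card_entrances [Fintype G] (e : G) (A : Finset G) :
    (Finset.univ.filter fun w => w ∉ A ∧ w + e ∈ A).card = (exits e A).card := by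
  have h1 : (Finset.univ.filter fun w => w + e ∈ A).card = A.card := by
    refine Finset.card_bij (fun w _ => w + e) (by simp) (by simp) fun b hb => ⟨b - e, by simpa⟩
  have h2 : (A.filter fun w => w + e ∈ A).card + (exits e A).card = A.card :=
    Finset.card_filter_add_card_filter_not (s := A) _
  have h3 := Finset.card_filter_add_card_filter_not
    (s := Finset.univ.filter fun w => w + e ∈ A) (fun w => w ∈ A)
  rw [Finset.filter_filter, Finset.filter_filter, h1] at h3
  have h4 : (Finset.univ.filter fun w => w + e ∈ A ∧ w ∈ A) = A.filter fun w => w + e ∈ A := by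
    ext w; simp [and_comm]
  have h5 : (Finset.univ.filter fun w => w + e ∈ A ∧ w ∉ A) =
      Finset.univ.filter fun w => w ∉ A ∧ w + e ∈ A := by
    ext w; simp [and_comm]
  rw [h4, h5] at h3
  omega

/-- A change of the value happens either on the boundary of `{f ≠ a}` or inside this set. -/
theorem disagreements_eq [Fintype G] (e : G) (f : G → T) (a : T) (A : Finset G)
    (hA : ∀ w, w ∈ A ↔ f w ≠ a) :
    disagreements e f = 2 * (exits e A).card +
      (Finset.univ.filter fun w => w ∈ A ∧ w + e ∈ A ∧ f w ≠ f (w + e)).card := by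
  have hex : exits e A = Finset.univ.filter fun w => w ∈ A ∧ w + e ∉ A := by
    ext w; simp [mem_exits]
  have h := card_entrances e A
  rw [two_mul]
  nth_rw 2 [← h]
  rw [hex, disagreements]
  simp only [Finset.card_filter, ← Finset.sum_add_distrib]
  refine Finset.sum_congr rfl fun w _ => ?_
  have h1 := hA w
  have h2 := hA (w + e)
  by_cases hw : w ∈ A <;> by_cases hw' : w + e ∈ A
  · simp [hw, hw']
  · have : f (w + e) = a := by tauto
    have h3 : f w ≠ f (w + e) := by rw [this]; tauto
    simp [hw, hw', h3]
  · have : f w = a := by tauto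
    have h3 : f w ≠ f (w + e) := by rw [this]; exact fun h => h2.1 hw' h.symm
    simp [hw, hw', h3]
  · have h3 : f w = f (w + e) := by
      have ha : f w = a := by tauto
      have hb : f (w + e) = a := by tauto
      rw [ha, hb]
    simp [hw, hw', h3]

/-- The change of the number of disagreements, if the value at one point is replaced by `c`. -/
theorem disagreements_update_le [Fintype G] {e : G} (he : e ≠ 0) (f : G → T) {v : G} {c : T}
    (hv : f v ≠ c) :
    disagreements e (Function.update f v c) +
      2 * ((if f (v + e) = c then 1 else 0) + (if f (v - e) = c then 1 else 0)) ≤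
      disagreements e f + 2 := by
  have h1 : v + e ≠ v := by simpa using he
  have h2 : v - e ≠ v := by simpa using he
  have hm : v - e ∈ (Finset.univ : Finset G).erase v := by simp [he]
  unfold disagreements
  simp only [Finset.card_filter]
  -- Only the summands at `v` and `v - e` involve the value at `v`.
  rw [← Finset.add_sum_erase _ _ (Finset.mem_univ v), ← Finset.add_sum_erase _ _ hm,
    ← Finset.add_sum_erase _ (fun w => if f w ≠ f (w + e) then 1 else 0) (Finset.mem_univ v),
    ← Finset.add_sum_erase _ (fun w => if f w ≠ f (w + e) then 1 else 0) hm]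
  have hrest : ∑ x ∈ ((Finset.univ : Finset G).erase v).erase (v - e),
      (if Function.update f v c x ≠ Function.update f v c (x + e) then 1 else 0) =
      ∑ x ∈ ((Finset.univ : Finset G).erase v).erase (v - e),
      (if f x ≠ f (x + e) then 1 else 0) := by
    refine Finset.sum_congr rfl fun x hx => ?_
    simp only [Finset.mem_erase, Finset.mem_univ, and_true] at hx
    have hx' : x + e ≠ v := fun h => hx.1 (by rw [← h]; simp)
    rw [Function.update_of_ne hx.2, Function.update_of_ne hx']
  rw [hrest]
  simp only [sub_add_cancel, Function.update_self, Function.update_of_ne h1,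
    Function.update_of_ne h2]
  have ha : (if c ≠ f (v + e) then 1 else 0) + 2 * (if f (v + e) = c then 1 else 0) ≤
      (if f v ≠ f (v + e) then 1 else 0) + 1 := by
    by_cases h : f (v + e) = c
    · simp [h, hv]
    · simp [h, Ne.symm h]
  have hb : (if f (v - e) ≠ c then 1 else 0) + 2 * (if f (v - e) = c then 1 else 0) ≤
      (if f (v - e) ≠ f v then 1 else 0) + 1 := by
    by_cases h : f (v - e) = c
    · simp [h, Ne.symm hv]
    · simp [h]
  omega

end Disagreement

/-! ### The energy in terms of the disagreements -/

namespace Potts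

variable {K L q : ℕ}

section Wall

variable [NeZero K] [NeZero L] {T : Type*} [DecidableEq T]

/-- The number of the edges of the torus on which `f` changes its value. -/
def wall (f : Vertex K L → T) : ℕ :=
  disagreements ((1, 0) : Vertex K L) f + disagreements ((0, 1) : Vertex K L) f

/-- The set of the vertices whose spin is not `1`. -/
def nonOne [NeZero q] (σ : Config K L q) : Finset (Vertex K L) :=
  Finset.univ.filter fun v => σ v ≠ spinOne q

end Wall

theorem mem_nonOne [NeZero K] [NeZero L] [NeZero q] {σ : Config K L q} {v : Vertex K L} :
    v ∈ nonOne σ ↔ σ v ≠ spinOne q := by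
  simp [nonOne]

theorem val_eq_one_iff [NeZero q] (a : Spin q) : (a : ℕ) = 1 ↔ a = spinOne q := by
  simp [spinOne, Subtype.ext_iff]

theorem zmod_one_ne_zero {n : ℕ} (hn : 3 ≤ n) : (1 : ZMod n) ≠ 0 := by
  intro h
  have := (ZMod.natCast_eq_zero_iff 1 n).1 (by exact_mod_cast h)
  have := Nat.le_of_dvd one_pos this
  omega

theorem zmod_one_add_one_ne_zero {n : ℕ} (hn : 3 ≤ n) : (1 + 1 : ZMod n) ≠ 0 := by
  intro h
  have := (ZMod.natCast_eq_zero_iff 2 n).1 (by push_cast; rw [← h]; norm_num)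
  have := Nat.le_of_dvd two_pos this
  omega

/-- The edge set is an image without multiplicities; `e + e ≠ 0` makes `v ↦ s(v, v + e)` injective,
so that its edges can be counted by vertices. -/
theorem sum_image_edges [NeZero K] [NeZero L] (σ : Config K L q) {e : Vertex K L}
    (he : e + e ≠ 0) :
    ∑ x ∈ Finset.univ.image (fun v : Vertex K L => s(v, v + e)),
      (if (x.map σ).IsDiag then (1 : ℝ) else 0) = K * L - disagreements e σ := by
  rw [Finset.sum_image]
  · simp only [Sym2.map_mk, Sym2.mk_isDiag_iff]
    have h := Finset.card_filter_add_card_filter_not (s := (Finset.univ : Finset (Vertex K L)))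
      (fun v => σ v = σ (v + e))
    rw [Finset.card_univ, Fintype.card_prod, ZMod.card, ZMod.card] at h
    rw [disagreements, Finset.sum_boole, eq_sub_iff_add_eq]
    exact_mod_cast h
  · intro v _ w _ hvw
    simp only [Sym2.eq_iff] at hvw
    rcases hvw with h | ⟨h1, h2⟩
    · exact h.1
    · exfalso
      apply he
      rw [h1] at h2
      have : w + (e + e) = w + 0 := by rw [← add_assoc, h2, add_zero]
      exact add_left_cancel this

theorem energy_eq [NeZero K] [NeZero L] [NeZero q] (hK : 3 ≤ K) (hL : 3 ≤ L) (h : ℝ)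
    (σ : Config K L q) :
    energy h σ = -2 * (K * L) + h * (K * L) + wall σ - h * (nonOne σ).card := by
  have hdisj : Disjoint (Finset.univ.image (fun v : Vertex K L => s(v, v + (1, 0))))
      (Finset.univ.image (fun v : Vertex K L => s(v, v + (0, 1)))) := by
    rw [Finset.disjoint_left]
    intro x hx hx'
    simp only [Finset.mem_image, Finset.mem_univ, true_and] at hx hx'
    obtain ⟨v, rfl⟩ := hx
    obtain ⟨w, hw⟩ := hx'
    rw [Sym2.eq_iff] at hw
    rcases hw with ⟨rfl, h2⟩ | ⟨rfl, h2⟩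
    · have := congrArg Prod.fst h2
      simp at this
      exact zmod_one_ne_zero hK this
    · have := congrArg Prod.fst h2
      simp at this
      exact zmod_one_ne_zero hK this
  have hfield : (∑ u : Vertex K L, if (σ u : ℕ) = 1 then (1 : ℝ) else 0) =
      K * L - (nonOne σ).card := by
    have h := Finset.card_filter_add_card_filter_not (s := (Finset.univ : Finset (Vertex K L)))
      (fun v => σ v = spinOne q)
    rw [Finset.card_univ, Fintype.card_prod, ZMod.card, ZMod.card] at h
    simp only [val_eq_one_iff]
    rw [nonOne, Finset.sum_boole, eq_sub_iff_add_eq]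
    exact_mod_cast h
  have h1 : ((1, 0) + (1, 0) : Vertex K L) ≠ 0 := fun h =>
    zmod_one_add_one_ne_zero hK (congrArg Prod.fst h)
  have h2 : ((0, 1) + (0, 1) : Vertex K L) ≠ 0 := fun h =>
    zmod_one_add_one_ne_zero hL (congrArg Prod.snd h)
  rw [energy, edges, Finset.sum_union hdisj, sum_image_edges σ h1, sum_image_edges σ h2, hfield,
    wall]
  push_cast
  ring

theorem connectivity_pos_iff [NeZero K] [NeZero L] [NeZero q] {σ σ' : Config K L q} :
    0 < connectivity σ σ' ↔ hammingDist σ σ' = 1 := by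
  have hq : (0 : ℝ) < q := by exact_mod_cast Nat.pos_of_ne_zero (NeZero.ne q)
  have hV : (0 : ℝ) < Fintype.card (Vertex K L) := by exact_mod_cast Fintype.card_pos
  unfold connectivity
  split_ifs with h
  · simp only [h, iff_true]
    positivity
  · simp [h]

theorem connectivity_update_pos [NeZero K] [NeZero L] [NeZero q] {σ : Config K L q}
    {v : Vertex K L} {c : Spin q} (hv : σ v ≠ c) :
    0 < connectivity σ (Function.update σ v c) := by
  rw [connectivity_pos_iff, hammingDist, Finset.card_eq_one]
  refine ⟨v, ?_⟩
  ext w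
  by_cases hw : w = v
  · subst hw; simp [hv]
  · simp [hw]

theorem exists_update_of_connectivity_pos [NeZero K] [NeZero L] [NeZero q] {σ σ' : Config K L q}
    (h : 0 < connectivity σ σ') : ∃ v, ∀ w, w ≠ v → σ' w = σ w := by
  rw [connectivity_pos_iff, hammingDist, Finset.card_eq_one] at h
  obtain ⟨v, hv⟩ := h
  refine ⟨v, fun w hw => ?_⟩
  by_contra hne
  have : w ∈ ({v} : Finset (Vertex K L)) := by
    rw [← hv]; simpa using Ne.symm hne
  exact hw (by simpa using this)

/-! ### Cyclic intervals -/

theorem zmod_forall_of_succ {n : ℕ} [NeZero n] {p : ZMod n → Prop} {z : ZMod n} (hz : p z)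
    (h : ∀ x, p x → p (x + 1)) (x : ZMod n) : p x := by
  have hk : ∀ k : ℕ, p (z + k) := by
    intro k
    induction k with
    | zero => simpa using hz
    | succ k ih => simpa [add_assoc] using h _ ih
  have := hk (x - z).val
  rwa [ZMod.natCast_zmod_val, add_sub_cancel] at this

/-- A function on a subset of the cycle that is left in at most one point is constant, if it does
not change in the steps inside the subset. -/
theorem eq_of_unique_exit {n : ℕ} [NeZero n] {T : Type*} {S : Finset (ZMod n)} {f : ZMod n → T}
    (hunique : ∀ x ∈ S, ∀ y ∈ S, x + 1 ∉ S → y + 1 ∉ S → x = y) (hne : ∃ x, x ∉ S)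
    (hf : ∀ x ∈ S, x + 1 ∈ S → f x = f (x + 1)) {x y : ZMod n} (hx : x ∈ S) (hy : y ∈ S) :
    f x = f y := by
  obtain ⟨u, hu⟩ := hne
  have hexit : ∃ z ∈ S, z + 1 ∉ S := by
    by_contra! hcon
    exact hu (zmod_forall_of_succ (p := fun x => x ∈ S) hx hcon u)
  obtain ⟨z, hz, hz'⟩ := hexit
  -- A point of `S` with a value other than `f z` cannot be the only exit `z`, so this property
  -- would propagate around the cycle and reach `z` itself.
  have key : ∀ x ∈ S, f x = f z := by
    intro x hx
    by_contra hne
    have := zmod_forall_of_succ (p := fun x => x ∈ S ∧ f x ≠ f z) ⟨hx, hne⟩ ?_ z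
    · exact this.2 rfl
    · rintro y ⟨hy, hyne⟩
      have hy' : y + 1 ∈ S := by
        by_contra hcon
        exact hyne (by rw [hunique y hy z hz hcon hz'])
      exact ⟨hy', by rwa [← hf y hy hy']⟩
  rw [key x hx, key y hy]

/-- A proper nonempty subset of the cycle that is left in one point only is an interval. -/
theorem exists_interval_of_unique_exit {n : ℕ} [NeZero n] {S : Finset (ZMod n)}
    (hunique : ∀ x ∈ S, ∀ y ∈ S, x + 1 ∉ S → y + 1 ∉ S → x = y) (hne : ∃ x, x ∉ S)
    (hS : S.Nonempty) : ∃ x₀, ∀ x, x ∈ S ↔ (x - x₀).val < S.card := by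
  have hcard : (exits 1 S).card ≤ 1 := by
    rw [Finset.card_le_one]
    intro a ha b hb
    rw [mem_exits] at ha hb
    exact hunique a ha.1 b hb.1 ha.2 hb.2
  -- One exit means one entrance, which becomes the left end of the interval.
  rw [← card_entrances, Finset.card_le_one] at hcard
  obtain ⟨u, hu⟩ := hne
  have hstart : ∃ w, w ∉ S ∧ w + 1 ∈ S := by
    by_contra! hcon
    obtain ⟨s, hs⟩ := hS
    exact zmod_forall_of_succ (p := fun x => x ∉ S) hu hcon s hs
  obtain ⟨w, hw, hw'⟩ := hstart
  have hpred : ∀ x ∈ S, x ≠ w + 1 → x - 1 ∈ S := by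
    intro x hx hxw
    by_contra hcon
    have := hcard (x - 1) (by simpa using ⟨hcon, hx⟩) w (by simpa using ⟨hw, hw'⟩)
    exact hxw (by rw [← this]; ring)
  have hdown : ∀ k : ℕ, k < n → w + 1 + k ∈ S → ∀ j ≤ k, w + 1 + j ∈ S := by
    intro k
    induction k with
    | zero => intro _ h j hj; simpa [Nat.le_zero.1 hj] using h
    | succ k ih =>
      intro hk h j hj
      rcases Nat.lt_or_ge j (k + 1) with hlt | hge
      · refine ih (by omega) ?_ j (by omega)
        have h2 := hpred _ h (by
          intro heq
          have h0 : ((k + 1 : ℕ) : ZMod n) = 0 := by simpa using heq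
          have := Nat.le_of_dvd (by omega) ((ZMod.natCast_eq_zero_iff _ _).1 h0)
          omega)
        have h3 : w + 1 + ((k + 1 : ℕ) : ZMod n) - 1 = w + 1 + k := by push_cast; ring
        rwa [h3] at h2
      · have : j = k + 1 := by omega
        rwa [this]
  refine ⟨w + 1, ?_⟩
  -- `J` is `S` in the coordinate counted from the entrance; by `hdown` it is an initial segment,
  -- hence determined by its cardinality.
  set J := (Finset.range n).filter fun k : ℕ => w + 1 + (k : ZMod n) ∈ S with hJ
  have hJcard : J.card = S.card := by
    refine Finset.card_bij (fun k _ => w + 1 + (k : ZMod n)) ?_ ?_ ?_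
    · intro k hk; exact (Finset.mem_filter.1 hk).2
    · intro a ha b hb hab
      simp only [hJ, Finset.mem_filter, Finset.mem_range] at ha hb
      have hab' : (a : ZMod n) = b := add_left_cancel hab
      have := congrArg ZMod.val hab'
      rwa [ZMod.val_natCast_of_lt ha.1, ZMod.val_natCast_of_lt hb.1] at this
    · intro x hx
      have hxx : w + 1 + (((x - (w + 1)).val : ℕ) : ZMod n) = x := by
        rw [ZMod.natCast_zmod_val]; ring
      exact ⟨(x - (w + 1)).val, by simp only [hJ, Finset.mem_filter, Finset.mem_range, hxx, hx,
        ZMod.val_lt, and_self], hxx⟩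
  have hJmem : ∀ k < n, (k ∈ J ↔ k < J.card) := by
    intro k hk
    constructor
    · intro hkJ
      have hsub : Finset.range (k + 1) ⊆ J := by
        intro j hj
        rw [Finset.mem_range] at hj
        exact Finset.mem_filter.2 ⟨Finset.mem_range.2 (by omega),
          hdown k hk (Finset.mem_filter.1 hkJ).2 j (by omega)⟩
      have := Finset.card_le_card hsub
      rw [Finset.card_range] at this
      omega
    · intro hlt
      by_contra hkJ
      have hsub : J ⊆ Finset.range k := by
        intro j hj
        rw [Finset.mem_range]
        by_contra hge
        have hj' := Finset.mem_filter.1 hj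
        exact hkJ (Finset.mem_filter.2 ⟨Finset.mem_range.2 hk,
          hdown j (Finset.mem_range.1 hj'.1) hj'.2 k (by omega)⟩)
      have := Finset.card_le_card hsub
      rw [Finset.card_range] at this
      omega
  intro x
  rw [← hJcard, ← hJmem _ (ZMod.val_lt _)]
  simp only [hJ, Finset.mem_filter, Finset.mem_range, ZMod.val_lt, true_and, ZMod.natCast_zmod_val]
  rw [add_sub_cancel]

/-! ### The isoperimetric inequality on the torus -/

section Torus

variable {l : ℕ} {A : Finset (Vertex K L)}

/-- Without an exit, walking along the line from a point of `A` would put the whole line into `A`.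
-/
theorem mem_image_exits_fst [NeZero K] {y : ZMod L} (hy : y ∈ A.image Prod.snd)
    (hfull : ∃ x, (x, y) ∉ A) : y ∈ (exits (1, 0) A).image Prod.snd := by
  simp only [Finset.mem_image, Prod.exists, exists_eq_right] at hy
  obtain ⟨x, hx⟩ := hy
  obtain ⟨u, hu⟩ := hfull
  by_contra hcon
  refine hu (zmod_forall_of_succ (p := fun x => (x, y) ∈ A) hx (fun z hz => ?_) u)
  by_contra hz'
  exact hcon (Finset.mem_image.2 ⟨(z, y), mem_exits.2 ⟨hz, by simpa using hz'⟩, rfl⟩)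

theorem mem_image_exits_snd [NeZero L] {x : ZMod K} (hx : x ∈ A.image Prod.fst)
    (hfull : ∃ y, (x, y) ∉ A) : x ∈ (exits (0, 1) A).image Prod.fst := by
  simp only [Finset.mem_image, Prod.exists, exists_and_right, exists_eq_right] at hx
  obtain ⟨y, hy⟩ := hx
  obtain ⟨u, hu⟩ := hfull
  by_contra hcon
  refine hu (zmod_forall_of_succ (p := fun y => (x, y) ∈ A) hy (fun z hz => ?_) u)
  by_contra hz'
  exact hcon (Finset.mem_image.2 ⟨(x, z), mem_exits.2 ⟨hz, by simpa using hz'⟩, rfl⟩)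

theorem card_le_card_image_mul : A.card ≤ (A.image Prod.fst).card * (A.image Prod.snd).card := by
  rw [← Finset.card_product]
  exact Finset.card_le_card Finset.subset_product

theorem card_nonfull_le_exits_fst [NeZero K] (A : Finset (Vertex K L)) :
    ((A.image Prod.snd).filter fun y => ∃ x, (x, y) ∉ A).card ≤ (exits (1, 0) A).card := by
  refine le_trans (Finset.card_le_card fun y hy => ?_)
    (Finset.card_image_le (s := exits (1, 0) A) (f := Prod.snd))
  rw [Finset.mem_filter] at hy
  exact mem_image_exits_fst hy.1 hy.2

theorem card_nonfull_le_exits_snd [NeZero L] (A : Finset (Vertex K L)) :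
    ((A.image Prod.fst).filter fun x => ∃ y, (x, y) ∉ A).card ≤ (exits (0, 1) A).card := by
  refine le_trans (Finset.card_le_card fun x hx => ?_)
    (Finset.card_image_le (s := exits (0, 1) A) (f := Prod.fst))
  rw [Finset.mem_filter] at hx
  exact mem_image_exits_snd hx.1 hx.2

/-- A full line meets all `K ≥ 3 * l` transversal lines. Each of these that is not full costs an
exit, so at most `2 * l` are not full; the remaining `l` or more lie in `A` with at least `3 * l`
vertices each, which exceeds the area `l ^ 2`. -/
theorem not_full_fst [NeZero K] [NeZero L] (hl : 0 < l) (hK : 3 * l ≤ K) (hL : 3 * l ≤ L)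
    (hA : A.card ≤ l ^ 2)
    (hper : (exits (1, 0) A).card + (exits (0, 1) A).card ≤ 2 * l) (y : ZMod L) :
    ∃ x, (x, y) ∉ A := by
  by_contra! hfull
  have himg : A.image Prod.fst = Finset.univ := by
    ext x; simpa using ⟨y, hfull x⟩
  have h1 := card_nonfull_le_exits_snd A
  rw [himg] at h1
  have h2 := Finset.card_filter_add_card_filter_not (s := (Finset.univ : Finset (ZMod K)))
    (fun x => ∃ y, (x, y) ∉ A)
  rw [Finset.card_univ, ZMod.card] at h2
  set F := Finset.univ.filter fun x : ZMod K => ¬ ∃ y, (x, y) ∉ A with hF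
  have h3 : F ×ˢ (Finset.univ : Finset (ZMod L)) ⊆ A := by
    rintro ⟨x, z⟩ hx
    simp only [hF, Finset.mem_product, Finset.mem_filter, Finset.mem_univ, true_and, and_true,
      not_exists, not_not] at hx
    exact hx z
  have h4 := Finset.card_le_card h3
  rw [Finset.card_product, Finset.card_univ, ZMod.card] at h4
  have h5 : l ≤ F.card := by omega
  nlinarith [Nat.mul_le_mul h5 hL]

theorem not_full_snd [NeZero K] [NeZero L] (hl : 0 < l) (hK : 3 * l ≤ K) (hL : 3 * l ≤ L)
    (hA : A.card ≤ l ^ 2)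
    (hper : (exits (1, 0) A).card + (exits (0, 1) A).card ≤ 2 * l) (x : ZMod K) :
    ∃ y, (x, y) ∉ A := by
  by_contra! hfull
  have himg : A.image Prod.snd = Finset.univ := by
    ext y; simpa using ⟨x, hfull y⟩
  have h1 := card_nonfull_le_exits_fst A
  rw [himg] at h1
  have h2 := Finset.card_filter_add_card_filter_not (s := (Finset.univ : Finset (ZMod L)))
    (fun y => ∃ x, (x, y) ∉ A)
  rw [Finset.card_univ, ZMod.card] at h2
  set F := Finset.univ.filter fun y : ZMod L => ¬ ∃ x, (x, y) ∉ A with hF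
  have h3 : (Finset.univ : Finset (ZMod K)) ×ˢ F ⊆ A := by
    rintro ⟨z, y⟩ hy
    simp only [hF, Finset.mem_product, Finset.mem_filter, Finset.mem_univ, true_and,
      not_exists, not_not] at hy
    exact hy z
  have h4 := Finset.card_le_card h3
  rw [Finset.card_product, Finset.card_univ, ZMod.card] at h4
  have h5 : l ≤ F.card := by omega
  nlinarith [Nat.mul_le_mul hK h5]

theorem card_image_snd_le [NeZero K] [NeZero L] (hl : 0 < l) (hK : 3 * l ≤ K) (hL : 3 * l ≤ L)
    (hA : A.card ≤ l ^ 2)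
    (hper : (exits (1, 0) A).card + (exits (0, 1) A).card ≤ 2 * l) :
    (A.image Prod.snd).card ≤ (exits (1, 0) A).card := by
  have h := card_nonfull_le_exits_fst A
  rwa [Finset.filter_true_of_mem fun y _ => not_full_fst hl hK hL hA hper y] at h

theorem card_image_fst_le [NeZero K] [NeZero L] (hl : 0 < l) (hK : 3 * l ≤ K) (hL : 3 * l ≤ L)
    (hA : A.card ≤ l ^ 2)
    (hper : (exits (1, 0) A).card + (exits (0, 1) A).card ≤ 2 * l) :
    (A.image Prod.fst).card ≤ (exits (0, 1) A).card := by
  have h := card_nonfull_le_exits_snd A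
  rwa [Finset.filter_true_of_mem fun x _ => not_full_snd hl hK hL hA hper x] at h

/-- If the number of exits in a direction is the number of the lines that meet the set, then every
line is left only once. -/
theorem exit_unique_fst [NeZero K] (hfull : ∀ y, ∃ x, (x, y) ∉ A)
    (hcard : (exits (1, 0) A).card ≤ (A.image Prod.snd).card) {x x' : ZMod K} {y : ZMod L}
    (hx : (x, y) ∈ A) (hx' : (x', y) ∈ A) (h1 : (x + 1, y) ∉ A) (h1' : (x' + 1, y) ∉ A) :
    x = x' := by
  have hsurj : A.image Prod.snd ⊆ (exits (1, 0) A).image Prod.snd :=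
    fun z hz => mem_image_exits_fst hz (hfull z)
  have hinj : Set.InjOn Prod.snd (exits ((1, 0) : Vertex K L) A : Set (Vertex K L)) := by
    rw [← Finset.card_image_iff]
    exact le_antisymm Finset.card_image_le (hcard.trans (Finset.card_le_card hsurj))
  have := hinj (x₁ := (x, y)) (x₂ := (x', y)) (mem_exits.2 ⟨hx, by simpa using h1⟩)
    (mem_exits.2 ⟨hx', by simpa using h1'⟩) rfl
  exact congrArg Prod.fst this

theorem exit_unique_snd [NeZero L] (hfull : ∀ x, ∃ y, (x, y) ∉ A)
    (hcard : (exits (0, 1) A).card ≤ (A.image Prod.fst).card) {x : ZMod K} {y y' : ZMod L}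
    (hy : (x, y) ∈ A) (hy' : (x, y') ∈ A) (h1 : (x, y + 1) ∉ A) (h1' : (x, y' + 1) ∉ A) :
    y = y' := by
  have hsurj : A.image Prod.fst ⊆ (exits (0, 1) A).image Prod.fst :=
    fun z hz => mem_image_exits_snd hz (hfull z)
  have hinj : Set.InjOn Prod.fst (exits ((0, 1) : Vertex K L) A : Set (Vertex K L)) := by
    rw [← Finset.card_image_iff]
    exact le_antisymm Finset.card_image_le (hcard.trans (Finset.card_le_card hsurj))
  have := hinj (x₁ := (x, y)) (x₂ := (x, y')) (mem_exits.2 ⟨hy, by simpa using h1⟩)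
    (mem_exits.2 ⟨hy', by simpa using h1'⟩) rfl
  exact congrArg Prod.snd this

end Torus

/-! ### Rectangles with a protuberance -/

section Protuberance

variable {m n : ℕ} [NeZero m] [NeZero n] {P : Finset (ZMod m)} {Q : Finset (ZMod n)} {a : ZMod m}
  {b : ZMod n} {p : ZMod m → ZMod n → Prop}

/-- If a product set together with one further point of a line that meets it is left only once in
every line, then it is a rectangle and the point is attached to one of its sides. -/
theorem exists_rectangle_of_unique_exits (hp : ∀ x y, p x y ↔ (x ∈ P ∧ y ∈ Q) ∨ (x = a ∧ y = b))
    (ha : a ∉ P) (hb : b ∈ Q) (hP : P.Nonempty) (hQ : 2 ≤ Q.card)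
    (hfull : ∀ x, ∃ y, ¬ p x y)
    (hfst : ∀ y x x', p x y → p x' y → ¬ p (x + 1) y → ¬ p (x' + 1) y → x = x')
    (hsnd : ∀ x y y', p x y → p x y' → ¬ p x (y + 1) → ¬ p x (y' + 1) → y = y') :
    ∃ x₀ y₀, (∀ x, x ∈ P ↔ (x - x₀).val < P.card) ∧ (∀ y, y ∈ Q ↔ (y - y₀).val < Q.card) ∧
      (a = x₀ + P.card ∨ a = x₀ - 1) := by
  -- The line at `y ≠ b` misses the additional point, so its trace is exactly `P`; the line at `x ∈
  -- P` has trace `Q`.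
  obtain ⟨y, hyQ, hyb⟩ : ∃ y ∈ Q, y ≠ b := Finset.exists_mem_ne (by omega) b
  obtain ⟨x, hxP⟩ := hP
  have hxa : x ≠ a := fun h => ha (h ▸ hxP)
  have hpy : ∀ x, p x y ↔ x ∈ P := fun x => by simp [hp, hyQ, hyb]
  have hpx : ∀ y, p x y ↔ y ∈ Q := fun y => by simp [hp, hxP, hxa]
  obtain ⟨x₀, hx₀⟩ := exists_interval_of_unique_exit (S := P)
    (fun u hu v hv hu' hv' => hfst y u v ((hpy u).2 hu) ((hpy v).2 hv)
      (fun h => hu' ((hpy _).1 h)) (fun h => hv' ((hpy _).1 h))) ⟨a, ha⟩ ⟨x, hxP⟩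
  obtain ⟨z, hz⟩ := hfull x
  obtain ⟨y₀, hy₀⟩ := exists_interval_of_unique_exit (S := Q)
    (fun u hu v hv hu' hv' => hsnd x u v ((hpx u).2 hu) ((hpx v).2 hv)
      (fun h => hu' ((hpx _).1 h)) (fun h => hv' ((hpx _).1 h))) ⟨z, fun h => hz ((hpx z).2 h)⟩
      ⟨b, hb⟩
  refine ⟨x₀, y₀, hx₀, hy₀, ?_⟩
  -- On the line at `b` the trace is `P ∪ {a}`. If `a` is adjacent to neither end of `P`, then `a`
  -- and the last point of `P` are two exits.
  by_contra! hcon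
  have hpb : ∀ x, p x b ↔ x ∈ P ∨ x = a := fun x => by simp [hp, hb]
  have hPpos : 0 < P.card := Finset.card_pos.2 ⟨x, hxP⟩
  have hak : P.card ≤ (a - x₀).val := by
    by_contra! h; exact ha ((hx₀ a).2 h)
  have haval : a = x₀ + ((a - x₀).val : ℕ) := by rw [ZMod.natCast_zmod_val]; ring
  have halt := ZMod.val_lt (a - x₀)
  set k := (a - x₀).val with hk
  have hk1 : k + 1 ≠ m := by
    intro h
    apply hcon.2
    rw [haval, eq_sub_iff_add_eq]
    have : ((k + 1 : ℕ) : ZMod m) = 0 := by rw [h, ZMod.natCast_self]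
    push_cast at this
    rw [add_assoc, this, add_zero]
  have ha1 : a + 1 ∉ P := by
    rw [hx₀, haval]
    have : x₀ + (k : ZMod m) + 1 - x₀ = ((k + 1 : ℕ) : ZMod m) := by push_cast; ring
    rw [this, ZMod.val_natCast_of_lt (by omega)]
    omega
  have ha2 : a + 1 ≠ a := by
    intro h
    have h1 : ((1 : ℕ) : ZMod m) = 0 := by simpa using h
    have := Nat.le_of_dvd one_pos ((ZMod.natCast_eq_zero_iff _ _).1 h1)
    omega
  have hzP : x₀ + ((P.card - 1 : ℕ) : ZMod m) ∈ P := by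
    rw [hx₀, add_sub_cancel_left, ZMod.val_natCast_of_lt (by omega)]
    omega
  have hz1 : x₀ + ((P.card - 1 : ℕ) : ZMod m) + 1 = x₀ + (P.card : ℕ) := by
    have : ((P.card : ℕ) : ZMod m) = ((P.card - 1 + 1 : ℕ) : ZMod m) := by
      rw [Nat.sub_add_cancel hPpos]
    rw [this]; push_cast; ring
  have hz2 : x₀ + ((P.card : ℕ) : ZMod m) ∉ P := by
    rw [hx₀, add_sub_cancel_left, ZMod.val_natCast_of_lt (by omega)]
    omega
  have := hfst b a _ ((hpb a).2 (Or.inr rfl)) ((hpb _).2 (Or.inl hzP))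
    (fun h => ((hpb _).1 h).elim ha1 ha2)
    (fun h => by
      rw [hz1] at h
      exact ((hpb _).1 h).elim hz2 fun h => hcon.1 h.symm)
  exact ha (this ▸ hzP)

/-- In the situation of `exists_rectangle_of_unique_exits`, a function that does not change along
the edges inside the set is constant on it. -/
theorem eq_of_unique_exits {T : Type*} {f : ZMod m → ZMod n → T}
    (hp : ∀ x y, p x y ↔ (x ∈ P ∧ y ∈ Q) ∨ (x = a ∧ y = b)) (hb : b ∈ Q) (hP : P.Nonempty)
    (hfull : ∀ y, ∃ x, ¬ p x y) (hfull' : ∀ x, ∃ y, ¬ p x y)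
    (hfst : ∀ y x x', p x y → p x' y → ¬ p (x + 1) y → ¬ p (x' + 1) y → x = x')
    (hsnd : ∀ x y y', p x y → p x y' → ¬ p x (y + 1) → ¬ p x (y' + 1) → y = y')
    (hf : ∀ x y, p x y → p (x + 1) y → f x y = f (x + 1) y)
    (hf' : ∀ x y, p x y → p x (y + 1) → f x y = f x (y + 1))
    {x x' : ZMod m} {y y' : ZMod n} (h : p x y) (h' : p x' y') : f x y = f x' y' := by
  classical
  obtain ⟨x₁, hx₁⟩ := hP
  have hcol : ∀ {x x' y}, p x y → p x' y → f x y = f x' y := by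
    intro x x' y hx hx'
    refine eq_of_unique_exit (S := Finset.univ.filter fun x => p x y) (f := fun x => f x y)
      (by simpa using fun u hu v hv hu' hv' => hfst y u v hu hv hu' hv') (by simpa using hfull y)
      (by simpa using fun u => hf u y) (by simpa using hx) (by simpa using hx')
  have hrow : ∀ {x y y'}, p x y → p x y' → f x y = f x y' := by
    intro x y y' hy hy'
    refine eq_of_unique_exit (S := Finset.univ.filter fun y => p x y) (f := fun y => f x y)
      (by simpa using fun u hu v hv hu' hv' => hsnd x u v hu hv hu' hv') (by simpa using hfull' x)
      (by simpa using fun u => hf' x u) (by simpa using hy) (by simpa using hy')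
  have hkey : ∀ {x y}, p x y → f x y = f x₁ b := by
    intro x y hxy
    have hy : y ∈ Q := by
      rcases (hp x y).1 hxy with h | h
      · exact h.2
      · exact h.2 ▸ hb
    have h1 : p x₁ y := (hp _ _).2 (Or.inl ⟨hx₁, hy⟩)
    exact (hcol hxy h1).trans (hrow h1 ((hp _ _).2 (Or.inl ⟨hx₁, hb⟩)))
  rw [hkey h, hkey h']

end Protuberance

theorem mem_rectangle_one_one [NeZero K] [NeZero L] {u v : Vertex K L} :
    v ∈ rectangle u 1 1 ↔ v = u := by
  simp [rectangle, ZMod.val_eq_zero, sub_eq_zero, Prod.ext_iff]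

/-! ### Sets of area at most `(k + 1) ^ 2` with small perimeter -/

section Droplet

variable [NeZero K] [NeZero L] {k : ℕ} {A A' : Finset (Vertex K L)}

/-- The number of exits in the two directions: half of the length of the boundary. -/
def halfPerimeter (A : Finset (Vertex K L)) : ℕ := (exits (1, 0) A).card + (exits (0, 1) A).card

/-- No line is full, so every line that meets `A` contributes an exit. -/
theorem card_image_add_le (hK : 3 * (k + 1) ≤ K) (hL : 3 * (k + 1) ≤ L)
    (hA : A.card ≤ (k + 1) ^ 2) (hper : halfPerimeter A ≤ 2 * (k + 1)) :
    (A.image Prod.fst).card + (A.image Prod.snd).card ≤ halfPerimeter A := by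
  have h1 := card_image_fst_le (Nat.succ_pos k) hK hL hA hper
  have h2 := card_image_snd_le (Nat.succ_pos k) hK hL hA hper
  unfold halfPerimeter
  omega

/-- `4 * a * b ≤ (a + b) ^ 2` and `(2 * k + 1) ^ 2 = 4 * k * (k + 1) + 1`, so a sum of at most `2 *
k + 1` allows only products up to `k * (k + 1)`. -/
theorem two_mul_le_of_card_lt {a b : ℕ} (h : k * (k + 1) < a * b) : 2 * (k + 1) ≤ a + b := by
  by_contra! hlt
  have h1 : a + b ≤ 2 * k + 1 := by omega
  have h2 : (a + b) ^ 2 ≤ (2 * k + 1) ^ 2 := Nat.pow_le_pow_left h1 2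
  zify at *
  nlinarith [sq_nonneg ((a : ℤ) - b)]

theorem eq_or_eq_of_card_le {a b : ℕ} (hk : 1 ≤ k) (h : k * (k + 1) ≤ a * b)
    (hab : a + b ≤ 2 * k + 1) :
    (a = k ∧ b = k + 1) ∨ (a = k + 1 ∧ b = k) := by
  rcases Nat.lt_or_ge a k with h1 | h1
  · exfalso; nlinarith
  · rcases Nat.lt_or_ge (k + 1) a with h2 | h2
    · exfalso; nlinarith
    · have ha : a = k ∨ a = k + 1 := by omega
      rcases ha with rfl | rfl
      · left
        refine ⟨rfl, ?_⟩
        rcases Nat.lt_or_ge b (a + 1) with h3 | h3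
        · exfalso
          nlinarith
        · omega
      · right
        refine ⟨rfl, ?_⟩
        rcases Nat.lt_or_ge b k with h3 | h3
        · exfalso; nlinarith
        · omega

/-- A set of `k (k + 1) + 1` vertices has half perimeter at least `2 (k + 1)`. -/
theorem two_mul_le_halfPerimeter (hK : 3 * (k + 1) ≤ K) (hL : 3 * (k + 1) ≤ L)
    (hA : A.card ≤ (k + 1) ^ 2) (hA' : k * (k + 1) < A.card) :
    2 * (k + 1) ≤ halfPerimeter A := by
  by_contra! hlt
  have h1 := card_image_add_le hK hL hA hlt.le
  have h2 := two_mul_le_of_card_lt (hA'.trans_le card_le_card_image_mul)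
  omega

/-- A rectangle `k × (k + 1)`, enlarged by one vertex to a set of minimal perimeter that meets
`k + 1` rows and `k + 1` columns, has a protuberance at one of its longest sides, and a function
that does not change inside this set is constant on it. -/
theorem insert_mem_rectanglesWithBar {T : Type*} {f : Vertex K L → T} {v : Vertex K L}
    (hk : 1 ≤ k) (hK : 3 * (k + 1) ≤ K) (hL : 3 * (k + 1) ≤ L) (hcard : A.card = k * (k + 1))
    (hper : halfPerimeter A ≤ 2 * k + 1) (hv : v ∉ A)
    (hper' : halfPerimeter (insert v A) ≤ 2 * (k + 1))
    (hfst : ((insert v A).image Prod.fst).card = k + 1)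
    (hsnd : ((insert v A).image Prod.snd).card = k + 1)
    (hf : ∀ w ∈ insert v A, w + (1, 0) ∈ insert v A → f w = f (w + (1, 0)))
    (hf' : ∀ w ∈ insert v A, w + (0, 1) ∈ insert v A → f w = f (w + (0, 1))) :
    (↑(insert v A) : Set (Vertex K L)) ∈ rectanglesWithBar K L k (k + 1) 1 ∧
      ∀ w ∈ insert v A, ∀ w' ∈ insert v A, f w = f w' := by
  have hcard' : (insert v A).card ≤ (k + 1) ^ 2 := by
    rw [Finset.card_insert_of_notMem hv, hcard]; nlinarith
  have hA : A.card ≤ (k + 1) ^ 2 := by rw [hcard]; nlinarith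
  have hfullf := not_full_fst (Nat.succ_pos k) hK hL hcard' hper'
  have hfulls := not_full_snd (Nat.succ_pos k) hK hL hcard' hper'
  have hlf := card_image_fst_le (Nat.succ_pos k) hK hL hcard' hper'
  have hls := card_image_snd_le (Nat.succ_pos k) hK hL hcard' hper'
  have hsum : (exits (1, 0) (insert v A)).card + (exits (0, 1) (insert v A)).card ≤ 2 * (k + 1) :=
    hper'
  -- The exits in each direction number at least `k + 1` and add up to at most `2 * (k + 1)`, so
  -- each number equals that of the lines met.
  have hUf : ∀ (y : ZMod L) (x x' : ZMod K), (x, y) ∈ insert v A → (x', y) ∈ insert v A →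
      (x + 1, y) ∉ insert v A → (x' + 1, y) ∉ insert v A → x = x' :=
    fun y x x' => exit_unique_fst hfullf (by omega)
  have hUs : ∀ (x : ZMod K) (y y' : ZMod L), (x, y) ∈ insert v A → (x, y') ∈ insert v A →
      (x, y + 1) ∉ insert v A → (x, y' + 1) ∉ insert v A → y = y' :=
    fun y x x' => exit_unique_snd hfulls (by omega)
  have hff : ∀ (x : ZMod K) (y : ZMod L), (x, y) ∈ insert v A → (x + 1, y) ∈ insert v A →
      f (x, y) = f (x + 1, y) := by
    intro x y h1 h2
    simpa using hf (x, y) h1 (by simpa using h2)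
  have hfs : ∀ (x : ZMod K) (y : ZMod L), (x, y) ∈ insert v A → (x, y + 1) ∈ insert v A →
      f (x, y) = f (x, y + 1) := by
    intro x y h1 h2
    simpa using hf' (x, y) h1 (by simpa using h2)
  set P := A.image Prod.fst with hP
  set Q := A.image Prod.snd with hQ
  have hab : P.card + Q.card ≤ halfPerimeter A := card_image_add_le hK hL hA (by omega)
  have hprod : k * (k + 1) ≤ P.card * Q.card := hcard ▸ card_le_card_image_mul
  have hshape := eq_or_eq_of_card_le hk hprod (by omega)
  -- The product of the projections has no more points than `A`, so `A` fills it.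
  have hAPQ : A = P ×ˢ Q := by
    refine Finset.eq_of_subset_of_card_le Finset.subset_product ?_
    rw [Finset.card_product, hcard]
    rcases hshape with ⟨h1, h2⟩ | ⟨h1, h2⟩ <;> rw [h1, h2]
    rw [mul_comm]
  obtain ⟨a, b⟩ := v
  rw [Finset.image_insert] at hfst hsnd
  have hmem : ∀ x y, (x, y) ∈ insert (a, b) A ↔ (x ∈ P ∧ y ∈ Q) ∨ (x = a ∧ y = b) := by
    intro x y
    rw [Finset.mem_insert, Prod.mk.injEq, hAPQ, Finset.mem_product, or_comm]
  -- The new vertex must enlarge the projection of size `k` and must not enlarge the other one,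
  -- which puts it next to a side of length `k + 1`.
  rcases hshape with ⟨h1, h2⟩ | ⟨h1, h2⟩
  · have ha : a ∉ P := by
      intro h
      rw [Finset.insert_eq_of_mem h] at hfst
      omega
    have hb : b ∈ Q := by
      by_contra h
      rw [Finset.card_insert_of_notMem h] at hsnd
      omega
    have hPne : P.Nonempty := Finset.card_pos.1 (by omega)
    constructor
    · obtain ⟨x₀, y₀, hx₀, hy₀, hside⟩ := exists_rectangle_of_unique_exits
        (p := fun x y => (x, y) ∈ insert (a, b) A) hmem ha hb hPne (by omega) hfulls hUf hUs
      rw [h1] at hx₀ hside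
      rw [h2] at hy₀
      have hbval : y₀ + (((b - y₀).val : ℕ) : ZMod L) = b := by rw [ZMod.natCast_zmod_val]; ring
      refine ⟨(x₀, y₀), (b - y₀).val, (hy₀ b).1 hb, ?_⟩
      rcases hside with hside | hside
      · left
        ext ⟨x, y⟩
        rw [Finset.mem_coe, hmem, Set.mem_union, mem_rectangle_one_one, hx₀, hy₀, rectangle]
        simp only [Set.mem_ofPred_eq, Prod.mk_add_mk, Prod.mk.injEq, hbval, hside]
      · rw [sub_eq_add_neg] at hside
        right; left
        ext ⟨x, y⟩
        rw [Finset.mem_coe, hmem, Set.mem_union, mem_rectangle_one_one, hx₀, hy₀, rectangle]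
        simp only [Set.mem_ofPred_eq, Prod.mk_add_mk, Prod.mk.injEq, hbval, hside]
    · rintro ⟨x, y⟩ hxy ⟨x', y'⟩ hxy'
      exact eq_of_unique_exits (p := fun x y => (x, y) ∈ insert (a, b) A) (f := fun x y => f (x, y))
        hmem hb hPne hfullf hfulls hUf hUs hff hfs hxy hxy'
  · have hb : b ∉ Q := by
      intro h
      rw [Finset.insert_eq_of_mem h] at hsnd
      omega
    have ha : a ∈ P := by
      by_contra h
      rw [Finset.card_insert_of_notMem h] at hfst
      omega
    have hQne : Q.Nonempty := Finset.card_pos.1 (by omega)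
    have hmem' : ∀ y x, (x, y) ∈ insert (a, b) A ↔ (y ∈ Q ∧ x ∈ P) ∨ (y = b ∧ x = a) := by
      intro y x
      rw [hmem, and_comm, and_comm (a := x = a)]
    constructor
    · obtain ⟨y₀, x₀, hy₀, hx₀, hside⟩ := exists_rectangle_of_unique_exits
        (p := fun y x => (x, y) ∈ insert (a, b) A) hmem' hb ha hQne (by omega) hfullf hUs hUf
      rw [h1] at hx₀
      rw [h2] at hy₀ hside
      have haval : x₀ + (((a - x₀).val : ℕ) : ZMod K) = a := by rw [ZMod.natCast_zmod_val]; ring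
      refine ⟨(x₀, y₀), (a - x₀).val, (hx₀ a).1 ha, ?_⟩
      rcases hside with hside | hside
      · right; right; left
        ext ⟨x, y⟩
        rw [Finset.mem_coe, hmem, Set.mem_union, mem_rectangle_one_one, hx₀, hy₀, rectangle]
        simp only [Set.mem_ofPred_eq, Prod.mk_add_mk, Prod.mk.injEq, haval, hside]
      · rw [sub_eq_add_neg] at hside
        right; right; right
        ext ⟨x, y⟩
        rw [Finset.mem_coe, hmem, Set.mem_union, mem_rectangle_one_one, hx₀, hy₀, rectangle]
        simp only [Set.mem_ofPred_eq, Prod.mk_add_mk, Prod.mk.injEq, haval, hside]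
    · rintro ⟨x, y⟩ hxy ⟨x', y'⟩ hxy'
      exact eq_of_unique_exits (p := fun y x => (x, y) ∈ insert (a, b) A) (f := fun y x => f (x, y))
        hmem' ha hQne hfulls hfullf hUs hUf (fun y x => hfs x y) (fun y x => hff x y) hxy hxy'

end Droplet

/-! ### The paths below the critical energy visit the critical set -/

/-- The energy of the critical droplet, where `k + 1` is the critical length. -/
def saddleEnergy (K L k : ℕ) (h : ℝ) : ℝ :=
  -2 * (K * L) + h * (K * L) + 4 * (k + 1) - h * (k * (k + 1) + 1)

/-- Non-integrality makes `2 / h < ⌈2 / h⌉₊` strict, and `h < 1` gives `2 / h > 2`, hence `k ≥ 2`.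
-/
theorem exists_criticalLength_eq {h : ℝ} (h_pos : 0 < h) (h_lt : h < 1)
    (h_int : ∀ n : ℤ, 2 / h ≠ n) :
    ∃ k : ℕ, criticalLength h = k + 1 ∧ 2 ≤ k ∧ h * k < 2 ∧ 2 < h * (k + 1) := by
  have h2 : 2 < 2 / h := by
    rw [lt_div_iff₀ h_pos]; linarith
  have hle : 2 / h ≤ criticalLength h := Nat.le_ceil _
  have hlt : (criticalLength h : ℝ) < 2 / h + 1 := Nat.ceil_lt_add_one (by linarith)
  have hne : 2 / h ≠ criticalLength h := by
    have := h_int (criticalLength h : ℤ)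
    push_cast at this
    exact this
  have hlt' : 2 / h < criticalLength h := lt_of_le_of_ne hle hne
  have h3 : 2 < criticalLength h := by
    have : (2 : ℝ) < criticalLength h := by linarith
    exact_mod_cast this
  obtain ⟨k, hk⟩ : ∃ k, criticalLength h = k + 1 := ⟨criticalLength h - 1, by omega⟩
  rw [hk] at hlt hlt' h3
  push_cast at hlt hlt'
  refine ⟨k, hk, by omega, ?_, ?_⟩
  · have : (k : ℝ) < 2 / h := by linarith
    rw [lt_div_iff₀ h_pos] at this
    linarith
  · rw [div_lt_iff₀ h_pos] at hlt'
    linarith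

section Step

variable [NeZero K] [NeZero L] [NeZero q] {k : ℕ} {h : ℝ} {σ σ' : Config K L q}

theorem wall_eq (σ : Config K L q) : wall σ = 2 * halfPerimeter (nonOne σ) +
    (Finset.univ.filter fun w => w ∈ nonOne σ ∧ w + (1, 0) ∈ nonOne σ ∧ σ w ≠ σ (w + (1, 0))).card +
    (Finset.univ.filter fun w =>
      w ∈ nonOne σ ∧ w + (0, 1) ∈ nonOne σ ∧ σ w ≠ σ (w + (0, 1))).card := by
  rw [wall, halfPerimeter, disagreements_eq (1, 0) σ (spinOne q) (nonOne σ) fun _ => mem_nonOne,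
    disagreements_eq (0, 1) σ (spinOne q) (nonOne σ) fun _ => mem_nonOne]
  ring

theorem energy_le_saddleEnergy_iff (hK : 3 ≤ K) (hL : 3 ≤ L) : energy h σ ≤ saddleEnergy K L k h ↔
    wall σ - h * (nonOne σ).card ≤ 4 * (k + 1) - h * (k * (k + 1) + 1) := by
  rw [energy_eq hK hL, saddleEnergy]
  constructor <;> intro h <;> linarith

/-- One vertex short of the critical area, the bound is `wall σ ≤ 4 * (k + 1) - h`, and strictness
costs a full unit of the half perimeter. -/
theorem halfPerimeter_le_of_card_eq (h_pos : 0 < h)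
    (hE : (wall σ : ℝ) - h * (nonOne σ).card ≤ 4 * (k + 1) - h * (k * (k + 1) + 1))
    (hcard : (nonOne σ).card = k * (k + 1)) : halfPerimeter (nonOne σ) ≤ 2 * k + 1 := by
  have h1 := wall_eq σ
  rw [hcard] at hE
  push_cast at hE
  have h2 : (wall σ : ℝ) < (4 * (k + 1) : ℕ) := by push_cast; linarith
  rw [Nat.cast_lt] at h2
  omega

/-- The area exceeds the critical one by at most `k`, a gain of at most `h * k < 2`, whereas one
more unit of half perimeter costs `2`. -/
theorem halfPerimeter_le_of_card_le (h_pos : 0 < h) (hk : h * k < 2)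
    (hE : (wall σ : ℝ) - h * (nonOne σ).card ≤ 4 * (k + 1) - h * (k * (k + 1) + 1))
    (hcard : (nonOne σ).card ≤ (k + 1) ^ 2) : halfPerimeter (nonOne σ) ≤ 2 * (k + 1) := by
  have h1 := wall_eq σ
  have h2 : ((nonOne σ).card : ℝ) ≤ (k + 1) ^ 2 := by exact_mod_cast hcard
  have h3 : (wall σ : ℝ) < (4 * (k + 1) + 2 : ℕ) := by
    push_cast
    nlinarith [mul_le_mul_of_nonneg_left h2 h_pos.le]
  rw [Nat.cast_lt] at h3
  omega

/-- The non-`1` sets of the configurations connected by a move differ in at most one vertex. -/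
theorem nonOne_of_connectivity_pos (hc : 0 < connectivity σ σ') :
    nonOne σ' = nonOne σ ∨ (∃ v, v ∉ nonOne σ ∧ nonOne σ' = insert v (nonOne σ)) ∨
      (∃ v, v ∉ nonOne σ' ∧ nonOne σ = insert v (nonOne σ')) := by
  obtain ⟨v, hv⟩ := exists_update_of_connectivity_pos hc
  have hmem : ∀ w, w ≠ v → (w ∈ nonOne σ' ↔ w ∈ nonOne σ) := by
    intro w hw
    rw [mem_nonOne, mem_nonOne, hv w hw]
  by_cases h1 : v ∈ nonOne σ <;> by_cases h2 : v ∈ nonOne σ'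
  · left; ext w; by_cases hw : w = v
    · subst hw; simp [h1, h2]
    · exact hmem w hw
  · right; right; refine ⟨v, h2, ?_⟩; ext w; by_cases hw : w = v
    · subst hw; simp [h1]
    · simp [hw, hmem w hw]
  · right; left; refine ⟨v, h1, ?_⟩; ext w; by_cases hw : w = v
    · subst hw; simp [h2]
    · simp [hw, hmem w hw]
  · left; ext w; by_cases hw : w = v
    · subst hw; simp [h1, h2]
    · exact hmem w hw

/-- The configurations with at most `(k + 1) ^ 2` non-`1` spins that are not yet on the way from a
`k × (k + 1)` rectangle to a `(k + 1) × (k + 1)` square. -/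
def subcritical (K L q k : ℕ) [NeZero K] [NeZero L] [NeZero q] : Set (Config K L q) :=
  {σ | (nonOne σ).card ≤ k * (k + 1) ∨ ((nonOne σ).card ≤ (k + 1) ^ 2 ∧
    ¬ (((nonOne σ).image Prod.fst).card = k + 1 ∧ ((nonOne σ).image Prod.snd).card = k + 1))}

theorem mem_criticalSet_of_crossing (hcrit : criticalLength h = k + 1) (hk2 : 2 ≤ k)
    (h_pos : 0 < h) (hk : h * k < 2) (hK : 3 * (k + 1) ≤ K) (hL : 3 * (k + 1) ≤ L)
    {v : Vertex K L} (hv : v ∉ nonOne σ) (hσ' : nonOne σ' = insert v (nonOne σ))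
    (hcard : (nonOne σ).card = k * (k + 1))
    (hE : (wall σ : ℝ) - h * (nonOne σ).card ≤ 4 * (k + 1) - h * (k * (k + 1) + 1))
    (hE' : (wall σ' : ℝ) - h * (nonOne σ').card ≤ 4 * (k + 1) - h * (k * (k + 1) + 1))
    (hfst : ((nonOne σ').image Prod.fst).card = k + 1)
    (hsnd : ((nonOne σ').image Prod.snd).card = k + 1) : σ' ∈ criticalSet K L q h := by
  have hcard' : (nonOne σ').card = k * (k + 1) + 1 := by
    rw [hσ', Finset.card_insert_of_notMem hv, hcard]
  have hle : (nonOne σ').card ≤ (k + 1) ^ 2 := by rw [hcard']; nlinarith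
  have hper := halfPerimeter_le_of_card_eq h_pos hE hcard
  have hper' := halfPerimeter_le_of_card_le h_pos hk hE' hle
  have hlow := two_mul_le_halfPerimeter hK hL hle (by omega)
  -- The boundary alone already accounts for `4 * (k + 1)` by `hlow`, so no disagreement is left
  -- inside the droplet.
  have hwall : wall σ' ≤ 4 * (k + 1) := by
    rw [hcard'] at hE'
    push_cast at hE'
    have : (wall σ' : ℝ) ≤ (4 * (k + 1) : ℕ) := by push_cast; linarith
    exact_mod_cast this
  have heq := wall_eq σ'
  have h1 : (Finset.univ.filter fun w => w ∈ nonOne σ' ∧ w + (1, 0) ∈ nonOne σ' ∧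
      σ' w ≠ σ' (w + (1, 0))).card = 0 := by omega
  have h2 : (Finset.univ.filter fun w => w ∈ nonOne σ' ∧ w + (0, 1) ∈ nonOne σ' ∧
      σ' w ≠ σ' (w + (0, 1))).card = 0 := by omega
  rw [Finset.card_eq_zero, Finset.filter_eq_empty_iff] at h1 h2
  rw [hσ'] at hper' hfst hsnd h1 h2
  obtain ⟨hR, hconst⟩ := insert_mem_rectanglesWithBar (f := σ') (by omega) hK hL hcard hper hv
    hper' hfst hsnd (fun w hw hw' => by_contra fun hne => h1 (Finset.mem_univ w) ⟨hw, hw', hne⟩)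
    (fun w hw hw' => by_contra fun hne => h2 (Finset.mem_univ w) ⟨hw, hw', hne⟩)
  rw [← hσ'] at hR hconst
  have hvmem : v ∈ nonOne σ' := by rw [hσ']; exact Finset.mem_insert_self _ _
  refine Set.mem_biUnion (x := σ' v) (mem_nonOne.1 hvmem) ?_
  rw [hcrit, Nat.add_sub_cancel]
  refine ⟨_, hR, fun w => ⟨fun hw => hconst w (by simpa using hw) v hvmem, fun hw => ?_⟩⟩
  by_contra hne
  exact hw (by simpa using mem_nonOne.2 hne)

/-- A protuberance on a short side can also have the critical energy, but it stays subcritical: with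
projections `k` and `k + 2` there is no room for `(k + 1) ^ 2` vertices. -/
theorem subcritical_step (hcrit : criticalLength h = k + 1) (hk2 : 2 ≤ k)
    (h_pos : 0 < h) (hk : h * k < 2) (hK : 3 * (k + 1) ≤ K) (hL : 3 * (k + 1) ≤ L)
    (hσ : energy h σ ≤ saddleEnergy K L k h) (hσ' : energy h σ' ≤ saddleEnergy K L k h)
    (hc : 0 < connectivity σ σ') (hB : σ ∈ subcritical K L q k)
    (hW : σ' ∉ criticalSet K L q h) : σ' ∈ subcritical K L q k := by
  rw [energy_le_saddleEnergy_iff (by omega) (by omega)] at hσ hσ'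
  -- Upper bound: half perimeter. Lower bound: the product of the projections has to hold more than
  -- `k * (k + 1)` vertices.
  have hkey : ∀ {τ : Config K L q},
      (wall τ : ℝ) - h * (nonOne τ).card ≤ 4 * (k + 1) - h * (k * (k + 1) + 1) →
      k * (k + 1) < (nonOne τ).card → (nonOne τ).card ≤ (k + 1) ^ 2 →
      ((nonOne τ).image Prod.fst).card + ((nonOne τ).image Prod.snd).card = 2 * (k + 1) := by
    intro τ hτ h1 h2
    have h3 := halfPerimeter_le_of_card_le h_pos hk hτ h2
    have h4 := card_image_add_le hK hL h2 h3
    have h5 := two_mul_le_of_card_lt (h1.trans_le card_le_card_image_mul)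
    omega
  have hsq : k * (k + 1) < (k + 1) ^ 2 := by nlinarith
  by_cases hlow' : (nonOne σ').card ≤ k * (k + 1)
  · exact Or.inl hlow'
  right
  rcases nonOne_of_connectivity_pos hc with heq | ⟨v, hv, heq⟩ | ⟨v, hv, heq⟩
  · rw [heq] at hlow' ⊢
    exact hB.resolve_left hlow'
  · have hcard' : (nonOne σ').card = (nonOne σ).card + 1 := by
      rw [heq, Finset.card_insert_of_notMem hv]
    by_cases hlow : (nonOne σ).card ≤ k * (k + 1)
    · refine ⟨by omega, fun hbox => hW ?_⟩
      exact mem_criticalSet_of_crossing hcrit hk2 h_pos hk hK hL hv heq (by omega) hσ hσ'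
        hbox.1 hbox.2
    · obtain ⟨hle, hbox⟩ := hB.resolve_left hlow
      have h1 := hkey hσ (by omega) hle
      have hlt : (nonOne σ).card < (k + 1) ^ 2 := by
        -- With sum `2 * (k + 1)` and product at least `(k + 1) ^ 2`, both projections have size `k
        -- + 1`, against `hbox`.
        refine lt_of_le_of_ne hle fun hcontra => hbox ?_
        have h2 := card_le_card_image_mul (A := nonOne σ)
        rw [hcontra] at h2
        have h3 : ((nonOne σ).image Prod.fst).card = k + 1 := by
          zify at h1 h2 ⊢
          have h4 : (((nonOne σ).image Prod.snd).card : ℤ) =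
            2 * (k + 1) - ((nonOne σ).image Prod.fst).card := by linarith
          rw [h4] at h2
          have h5 : ((((nonOne σ).image Prod.fst).card : ℤ) - (k + 1)) ^ 2 ≤ 0 := by nlinarith
          have h6 := pow_eq_zero_iff (two_ne_zero) |>.1 (le_antisymm h5 (sq_nonneg _))
          linarith
        exact ⟨h3, by omega⟩
      -- Both projections can only grow while their sum is fixed, so their sizes do not change.
      have h2 := hkey hσ' (by omega) (by omega)
      have hsubf : (nonOne σ).image Prod.fst ⊆ (nonOne σ').image Prod.fst :=
        Finset.image_subset_image (by rw [heq]; exact Finset.subset_insert _ _)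
      have hsubs : (nonOne σ).image Prod.snd ⊆ (nonOne σ').image Prod.snd :=
        Finset.image_subset_image (by rw [heq]; exact Finset.subset_insert _ _)
      have h3 := Finset.card_le_card hsubf
      have h4 := Finset.card_le_card hsubs
      exact ⟨by omega, by omega⟩
  · have hcard' : (nonOne σ).card = (nonOne σ').card + 1 := by
      rw [heq, Finset.card_insert_of_notMem hv]
    obtain ⟨hle, hbox⟩ := hB.resolve_left (by omega)
    have h1 := hkey hσ (by omega) hle
    have h2 := hkey hσ' (by omega) (by omega)
    have hsubf : (nonOne σ').image Prod.fst ⊆ (nonOne σ).image Prod.fst :=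
      Finset.image_subset_image (by rw [heq]; exact Finset.subset_insert _ _)
    have hsubs : (nonOne σ').image Prod.snd ⊆ (nonOne σ).image Prod.snd :=
      Finset.image_subset_image (by rw [heq]; exact Finset.subset_insert _ _)
    have h3 := Finset.card_le_card hsubf
    have h4 := Finset.card_le_card hsubs
    exact ⟨by omega, by omega⟩

/-! ### The stable states -/

theorem wall_const {T : Type*} [DecidableEq T] (c : T) : wall (fun _ : Vertex K L => c) = 0 := by
  simp [wall, disagreements]

/-- The stable states are constant, with a spin that is not `1`. -/
theorem exists_eq_const_of_mem_stableStates (hq : 1 < q) (h_pos : 0 < h) (hK : 3 ≤ K) (hL : 3 ≤ L)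
    {s : Config K L q} (hs : s ∈ EnergyLandscape.stableStates (energy h)) :
    ∃ c : Spin q, c ≠ spinOne q ∧ s = fun _ => c := by
  let two : Spin q := ⟨2, Finset.mem_Icc.2 ⟨by norm_num, hq⟩⟩
  have htwo : two ≠ spinOne q := by simp [two, spinOne]
  -- This constant configuration has the least wall, `0`, and the most non-`1` spins, `K * L`; a
  -- minimizer must attain both.
  have h1 := hs fun _ => two
  have hfull : nonOne (fun _ : Vertex K L => two) = Finset.univ := by
    ext v; simp [mem_nonOne, htwo]
  rw [energy_eq hK hL, energy_eq hK hL, wall_const, hfull, Finset.card_univ, Fintype.card_prod,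
    ZMod.card, ZMod.card] at h1
  have h2 : (nonOne s).card ≤ K * L := by
    refine (Finset.card_le_univ _).trans ?_
    rw [Fintype.card_prod, ZMod.card, ZMod.card]
  have h2' : ((nonOne s).card : ℝ) ≤ K * L := by exact_mod_cast h2
  push_cast at h1
  have hw0 : (0 : ℝ) ≤ wall s := Nat.cast_nonneg _
  have hm : h * (nonOne s).card ≤ h * (K * L) := mul_le_mul_of_nonneg_left h2' h_pos.le
  have hwall : wall s = 0 := by
    have : (wall s : ℝ) = 0 := by linarith
    exact_mod_cast this
  have hcard : (nonOne s).card = K * L := by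
    have h3 : h * (nonOne s).card = h * (K * L) := by linarith
    have := mul_left_cancel₀ h_pos.ne' h3
    exact_mod_cast this
  have huniv : nonOne s = Finset.univ := by
    rw [← Finset.card_eq_iff_eq_univ, hcard, Fintype.card_prod, ZMod.card, ZMod.card]
  rw [wall, Nat.add_eq_zero_iff, disagreements, disagreements, Finset.card_eq_zero,
    Finset.card_eq_zero, Finset.filter_eq_empty_iff, Finset.filter_eq_empty_iff] at hwall
  simp only [Finset.mem_univ, forall_const, not_not] at hwall
  refine ⟨s 0, mem_nonOne.1 (huniv ▸ Finset.mem_univ 0), ?_⟩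
  have hx : ∀ x : ZMod K, s (x, 0) = s 0 := by
    refine zmod_forall_of_succ (z := 0) rfl fun x hx => ?_
    have := @hwall.1 (x, 0)
    simp only [Prod.mk_add_mk, add_zero] at this
    rw [← this, hx]
  funext ⟨x, y⟩
  refine zmod_forall_of_succ (p := fun y => s (x, y) = s 0) (z := 0) (hx x) (fun y hy => ?_) y
  have := @hwall.2 (x, y)
  simp only [Prod.mk_add_mk, add_zero] at this
  rw [← this, hy]

theorem visits_criticalSet (hq : 1 < q) (hcrit : criticalLength h = k + 1) (hk2 : 2 ≤ k)
    (h_pos : 0 < h) (hk : h * k < 2) (hK : 3 * (k + 1) ≤ K) (hL : 3 * (k + 1) ≤ L)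
    {A : Set (Config K L q)} (hA : A ⊆ EnergyLandscape.stableStates (energy h))
    (ω : EnergyLandscape.Path connectivity)
    (hω : ω ∈ EnergyLandscape.paths connectivity (allOne K L q) A)
    (hheight : EnergyLandscape.height (energy h) ω ≤ saddleEnergy K L k h) :
    ∃ η ∈ criticalSet K L q h, η ∈ ω := by
  rw [EnergyLandscape.height_le_iff] at hheight
  refine EnergyLandscape.exists_mem_of_leaves (B := subcritical K L q k)
    (fun x hx y hy hxB hxy hyW => subcritical_step hcrit hk2 h_pos hk hK hL (hheight x hx)
      (hheight y hy) hxy hxB hyW) ?_ ?_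
  · rw [hω.1]
    left
    have : nonOne (allOne K L q) = ∅ := by
      ext v; simp [mem_nonOne, allOne]
    rw [this]
    simp
  · obtain ⟨c, hc, hlast⟩ := exists_eq_const_of_mem_stableStates hq h_pos (by omega) (by omega)
      (hA hω.2)
    have hfull : nonOne ω.last = Finset.univ := by
      rw [hlast]; ext v; simp [mem_nonOne, hc]
    have hcard : (nonOne ω.last).card = K * L := by
      rw [hfull, Finset.card_univ, Fintype.card_prod, ZMod.card, ZMod.card]
    have h1 := Nat.mul_le_mul hK hL
    rintro (h2 | ⟨h2, -⟩) <;> rw [hcard] at h2 <;> nlinarith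

end Step

/-! ### Growing droplets -/

section Bars

/-- The adjacency of the vertices of the torus. -/
def IsNeighbor (v w : Vertex K L) : Prop :=
  w = v + (1, 0) ∨ w = v - (1, 0) ∨ w = v + (0, 1) ∨ w = v - (0, 1)

/-- The points `f 0, …, f (b - 1)` form a side of `R`: they can be attached to it one by one. -/
structure IsSide (R : Finset (Vertex K L)) (b : ℕ) (f : ℕ → Vertex K L) : Prop where
  notMem : ∀ i < b, f i ∉ R
  inj : ∀ i < b, ∀ j < b, f i = f j → i = j
  attached : ∀ i < b, ∃ u ∈ R, IsNeighbor (f i) u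
  next : ∀ i, i + 1 < b → IsNeighbor (f (i + 1)) (f i)

/-- The set `R` with the points `f i, …, f (j - 1)` attached. -/
def withBar (R : Finset (Vertex K L)) (f : ℕ → Vertex K L) (i j : ℕ) : Finset (Vertex K L) :=
  R ∪ (Finset.Ico i j).image f

variable {R : Finset (Vertex K L)} {f : ℕ → Vertex K L} {b i j : ℕ}

theorem mem_withBar {v : Vertex K L} :
    v ∈ withBar R f i j ↔ v ∈ R ∨ ∃ k, (i ≤ k ∧ k < j) ∧ f k = v := by
  simp [withBar]

theorem withBar_self : withBar R f i i = R := by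
  simp [withBar]

theorem withBar_succ (hij : i ≤ j) : withBar R f i (j + 1) = insert (f j) (withBar R f i j) := by
  rw [withBar, withBar, ← Finset.insert_Ico_right_eq_Ico_add_one hij, Finset.image_insert,
    Finset.union_insert]

theorem withBar_pred (hij : i < j) :
    withBar R f i j = insert (f i) (withBar R f (i + 1) j) := by
  rw [withBar, withBar, ← Finset.insert_Ico_add_one_left_eq_Ico hij, Finset.image_insert,
    Finset.union_insert]

theorem IsSide.notMem_withBar (hf : IsSide R b f) {k : ℕ} (hj : j ≤ b) (hk : k < b)
    (hkij : k < i ∨ j ≤ k) : f k ∉ withBar R f i j := by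
  rw [mem_withBar]
  rintro (h | ⟨k', hk', h⟩)
  · exact hf.notMem k hk h
  · have := hf.inj k' (by omega) k hk h
    omega

theorem IsSide.card_withBar (hf : IsSide R b f) (hj : j ≤ b) :
    (withBar R f i j).card = R.card + (j - i) := by
  rw [withBar, Finset.card_union_of_disjoint, Finset.card_image_of_injOn, Nat.card_Ico]
  · intro x hx y hy hxy
    rw [Finset.coe_Ico, Set.mem_Ico] at hx hy
    exact hf.inj x (by omega) y (by omega) hxy
  · rw [Finset.disjoint_left]
    intro v hv hv'
    obtain ⟨k, hk, rfl⟩ := Finset.mem_image.1 hv'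
    rw [Finset.mem_Ico] at hk
    exact hf.notMem k (by omega) hv

end Bars

section Growth

variable [NeZero K] [NeZero L]

/-- The length of the boundary of a set of vertices. -/
def perimeter (R : Finset (Vertex K L)) : ℕ := wall fun v => decide (v ∈ R)

theorem perimeter_empty : perimeter (∅ : Finset (Vertex K L)) = 0 := by
  simp [perimeter, wall_const]

theorem wall_update_le (hK : 3 ≤ K) (hL : 3 ≤ L) {T : Type*} [DecidableEq T]
    (f : Vertex K L → T) {v : Vertex K L} {c : T} (hv : f v ≠ c) :
    wall (Function.update f v c) + 2 * (((if f (v + (1, 0)) = c then 1 else 0) +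
      (if f (v - (1, 0)) = c then 1 else 0)) + ((if f (v + (0, 1)) = c then 1 else 0) +
      (if f (v - (0, 1)) = c then 1 else 0))) ≤ wall f + 4 := by
  have h1 : ((1, 0) : Vertex K L) ≠ 0 := fun h => zmod_one_ne_zero hK (congrArg Prod.fst h)
  have h2 : ((0, 1) : Vertex K L) ≠ 0 := fun h => zmod_one_ne_zero hL (congrArg Prod.snd h)
  have h3 := disagreements_update_le h1 f hv
  have h4 := disagreements_update_le h2 f hv
  unfold wall
  omega

/-- Of the four edges at `v`, each one leading into `R` leaves the boundary and each other one may
join it. -/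
theorem perimeter_insert_le (hK : 3 ≤ K) (hL : 3 ≤ L) {R : Finset (Vertex K L)} {v : Vertex K L}
    (hv : v ∉ R) : perimeter (insert v R) + 2 * (((if v + (1, 0) ∈ R then 1 else 0) +
      (if v - (1, 0) ∈ R then 1 else 0)) + ((if v + (0, 1) ∈ R then 1 else 0) +
      (if v - (0, 1) ∈ R then 1 else 0))) ≤ perimeter R + 4 := by
  have hupd : (fun w => decide (w ∈ insert v R)) =
      Function.update (fun w => decide (w ∈ R)) v true := by
    funext w
    by_cases hw : w = v
    · subst hw; simp
    · simp [hw]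
  have h := wall_update_le hK hL (fun w => decide (w ∈ R)) (v := v) (c := true) (by simpa using hv)
  simp only [decide_eq_true_eq] at h
  rw [perimeter, perimeter, hupd]
  exact h

theorem perimeter_insert_le_add_two (hK : 3 ≤ K) (hL : 3 ≤ L) {R : Finset (Vertex K L)}
    {v u : Vertex K L} (hv : v ∉ R) (hu : u ∈ R) (hvu : IsNeighbor v u) :
    perimeter (insert v R) ≤ perimeter R + 2 := by
  have h := perimeter_insert_le hK hL hv
  rcases hvu with rfl | rfl | rfl | rfl <;> rw [if_pos hu] at h <;> omega

theorem perimeter_insert_le_self (hK : 3 ≤ K) (hL : 3 ≤ L) {R : Finset (Vertex K L)}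
    {v u w : Vertex K L} (hv : v ∉ R) (hu : u ∈ R) (hw : w ∈ R) (huw : u ≠ w)
    (hvu : IsNeighbor v u) (hvw : IsNeighbor v w) : perimeter (insert v R) ≤ perimeter R := by
  have h := perimeter_insert_le hK hL hv
  rcases hvu with rfl | rfl | rfl | rfl <;> rcases hvw with rfl | rfl | rfl | rfl <;>
    first
      | exact absurd rfl huw
      | (rw [if_pos hu, if_pos hw] at h; omega)

/-- The droplets grow vertex by vertex, with the energy (with field `g`) below `θ` after every
step. -/
def Grows (g θ : ℝ) : Finset (Vertex K L) → Finset (Vertex K L) → Prop :=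
  Relation.ReflTransGen fun R R' =>
    ((perimeter R' : ℝ) - g * R'.card < θ) ∧ ∃ v ∉ R, R' = insert v R

variable {R : Finset (Vertex K L)} {f : ℕ → Vertex K L} {b i j : ℕ} {g θ : ℝ}

/-- The first vertex of the bar costs at most `2`; each further one touches both `R` and its
predecessor and costs nothing. -/
theorem IsSide.perimeter_withBar_le (hK : 3 ≤ K) (hL : 3 ≤ L) (hf : IsSide R b f) (hij : i < j)
    (hj : j ≤ b) : perimeter (withBar R f i j) ≤ perimeter R + 2 := by
  induction j, hij using Nat.le_induction with
  | base =>
    obtain ⟨u, hu, hu'⟩ := hf.attached i (by omega)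
    rw [withBar_succ le_rfl, withBar_self]
    exact perimeter_insert_le_add_two hK hL (hf.notMem i (by omega)) hu hu'
  | succ j hij ih =>
    obtain ⟨u, hu, hu'⟩ := hf.attached j (by omega)
    obtain ⟨j, rfl⟩ : ∃ j', j = j' + 1 := ⟨j - 1, by omega⟩
    rw [withBar_succ (by omega)]
    refine (perimeter_insert_le_self hK hL (w := f j)
      (hf.notMem_withBar (by omega) (by omega) (Or.inr le_rfl)) (mem_withBar.2 (Or.inl hu))
      (mem_withBar.2 (Or.inr ⟨j, ⟨by omega, by omega⟩, rfl⟩)) ?_ hu' (hf.next j (by omega))).trans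
      (ih (by omega))
    rintro rfl
    exact hf.notMem j (by omega) hu

/-- The perimeter bound is independent of the length of the bar, so it suffices to have `hθ` at
length `n + 1`. -/
theorem IsSide.energy_withBar_lt (hK : 3 ≤ K) (hL : 3 ≤ L) (hg : 0 ≤ g) (hf : IsSide R b f)
    (hj : j ≤ b) {n : ℕ} (hn : i + n < j)
    (hθ : (perimeter R : ℝ) + 2 - g * (R.card + (n + 1)) < θ) :
    (perimeter (withBar R f i j) : ℝ) - g * (withBar R f i j).card < θ := by
  have h1 : (perimeter (withBar R f i j) : ℝ) ≤ perimeter R + 2 := by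
    exact_mod_cast hf.perimeter_withBar_le hK hL (by omega) hj
  have h2 : ((n : ℝ) + 1) ≤ (j - i : ℕ) := by
    have : n + 1 ≤ j - i := by omega
    exact_mod_cast this
  rw [hf.card_withBar hj, Nat.cast_add]
  nlinarith [mul_le_mul_of_nonneg_left h2 hg]

/-- A bar can be prolonged in both directions. -/
theorem IsSide.grows_withBar (hK : 3 ≤ K) (hL : 3 ≤ L) (hg : 0 ≤ g) (hf : IsSide R b f)
    {i' j' : ℕ} (hi : i' ≤ i) (hij : i ≤ j) (hj : j ≤ j') (hj' : j' ≤ b)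
    (hθ : (perimeter R : ℝ) + 2 - g * (R.card + ((j - i : ℕ) + 1)) < θ) :
    Grows g θ (withBar R f i j) (withBar R f i' j') := by
  have hright : Grows g θ (withBar R f i j) (withBar R f i j') := by
    induction j', hj using Nat.le_induction with
    | base => exact Relation.ReflTransGen.refl
    | succ j' hj ih =>
      exact (ih (by omega)).tail ⟨hf.energy_withBar_lt hK hL hg hj' (by omega) hθ, f j',
        hf.notMem_withBar (by omega) (by omega) (Or.inr le_rfl), withBar_succ (by omega)⟩
  have hleft : ∀ d ≤ i, Grows g θ (withBar R f i j') (withBar R f (i - d) j') := by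
    intro d
    induction d with
    | zero => exact fun _ => Relation.ReflTransGen.refl
    | succ d ih =>
      intro hd
      refine (ih (by omega)).tail ⟨hf.energy_withBar_lt hK hL hg hj' (by omega) hθ,
        f (i - (d + 1)), hf.notMem_withBar (by omega) (by omega) (Or.inl (by omega)), ?_⟩
      rw [withBar_pred (by omega), show i - (d + 1) + 1 = i - d by omega]
  have := hleft (i - i') (by omega)
  rw [show i - (i - i') = i' by omega] at this
  exact hright.trans this

end Growth

/-! ### Rectangles on the torus -/

theorem val_neg_one_add_one {n : ℕ} [NeZero n] : (-1 : ZMod n).val + 1 = n := by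
  obtain ⟨m, rfl⟩ : ∃ m, n = m + 1 := ⟨n - 1, (Nat.succ_pred (NeZero.ne n)).symm⟩
  rw [ZMod.val_neg_one]

theorem val_sub_lt_succ_iff {n m : ℕ} [NeZero n] (hm : m < n) (x x₀ : ZMod n) :
    (x - x₀).val < m + 1 ↔ (x - x₀).val < m ∨ x = x₀ + m := by
  rw [Nat.lt_succ_iff_lt_or_eq]
  refine or_congr_right ⟨fun h => ?_, fun h => ?_⟩
  · rw [← h, ZMod.natCast_zmod_val]; ring
  · rw [h, add_sub_cancel_left, ZMod.val_natCast_of_lt hm]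

/-- Adding `1` to `x - x₀` raises its representative by one, except when `x - x₀ = -1`, which wraps
to `0`. -/
theorem val_sub_pred_lt_succ_iff {n m : ℕ} [NeZero n] (x x₀ : ZMod n) :
    (x - (x₀ + -1)).val < m + 1 ↔ (x - x₀).val < m ∨ x = x₀ + -1 := by
  have hx : x - (x₀ + -1) = (x - x₀) + 1 := by ring
  rw [hx]
  have hlt := ZMod.val_lt (x - x₀)
  rcases Nat.lt_or_ge ((x - x₀).val + 1) n with h | h
  · have h1 : ((x - x₀) + 1).val = (x - x₀).val + 1 := by
      have : (x - x₀) + 1 = (((x - x₀).val + 1 : ℕ) : ZMod n) := by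
        push_cast; rw [ZMod.natCast_zmod_val]
      rw [this, ZMod.val_natCast_of_lt h]
    rw [h1, Nat.add_lt_add_iff_right]
    refine ⟨Or.inl, fun h2 => h2.resolve_right fun h3 => ?_⟩
    rw [h3, add_sub_cancel_left] at h
    have := val_neg_one_add_one (n := n)
    omega
  · have h2 : x - x₀ = -1 := by
      apply ZMod.val_injective
      have := val_neg_one_add_one (n := n)
      omega
    have h3 : x = x₀ + -1 := by rw [← h2]; ring
    simp [h3]

theorem val_sub_lt_iff_exists {n m : ℕ} [NeZero n] (hm : m ≤ n) (x x₀ : ZMod n) :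
    (x - x₀).val < m ↔ ∃ i < m, x₀ + (i : ZMod n) = x := by
  constructor
  · exact fun h => ⟨_, h, by rw [ZMod.natCast_zmod_val]; ring⟩
  · rintro ⟨i, hi, rfl⟩
    rw [add_sub_cancel_left, ZMod.val_natCast_of_lt (by omega)]
    exact hi

section Rectangles

variable [NeZero K] [NeZero L]

/-- The rectangle with corner `v₀`, `m` rows and `n` columns, as a finite set. -/
def rect (v₀ : Vertex K L) (m n : ℕ) : Finset (Vertex K L) :=
  Finset.univ.filter fun v => (v.1 - v₀.1).val < m ∧ (v.2 - v₀.2).val < n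

variable {v₀ : Vertex K L} {m n : ℕ}

theorem mem_rect {v : Vertex K L} :
    v ∈ rect v₀ m n ↔ (v.1 - v₀.1).val < m ∧ (v.2 - v₀.2).val < n := by
  simp [rect]

theorem coe_rect : (rect v₀ m n : Set (Vertex K L)) = rectangle v₀ m n := by
  ext v; simp [rect, rectangle]

theorem natCast_injective_of_lt {N i j : ℕ} (hi : i < N) (hj : j < N)
    (h : (i : ZMod N) = j) : i = j := by
  have := congrArg ZMod.val h
  rwa [ZMod.val_natCast_of_lt hi, ZMod.val_natCast_of_lt hj] at this

/-- A row next to a rectangle is one of its sides. -/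
theorem isSide_row {a : ZMod K} (ha : ¬ a.val < m) (ha' : (a + 1).val < m ∨ (a - 1).val < m)
    (hn : n ≤ L) : IsSide (rect v₀ m n) n fun i => v₀ + (a, (i : ZMod L)) where
  notMem i _ h := ha (by simpa using (mem_rect.1 h).1)
  inj i hi j hj h := natCast_injective_of_lt (N := L) (by omega) (by omega)
    (by simpa using congrArg Prod.snd h)
  attached i hi := by
    have hv : ((i : ℕ) : ZMod L).val < n := by rwa [ZMod.val_natCast_of_lt (by omega)]
    rcases ha' with h | h
    · refine ⟨v₀ + (a, (i : ZMod L)) + (1, 0), mem_rect.2 ?_, Or.inl rfl⟩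
      simpa [add_assoc, -ZMod.val_natCast] using ⟨h, hv⟩
    · refine ⟨v₀ + (a, (i : ZMod L)) - (1, 0), mem_rect.2 ?_, Or.inr (Or.inl rfl)⟩
      simpa [add_sub_assoc, -ZMod.val_natCast] using ⟨h, hv⟩
  next i _ := Or.inr (Or.inr (Or.inr (Prod.ext (by simp) (by simp; ring))))

/-- A column next to a rectangle is one of its sides. -/
theorem isSide_col {a : ZMod L} (ha : ¬ a.val < n) (ha' : (a + 1).val < n ∨ (a - 1).val < n)
    (hm : m ≤ K) : IsSide (rect v₀ m n) m fun i => v₀ + ((i : ZMod K), a) where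
  notMem i _ h := ha (by simpa using (mem_rect.1 h).2)
  inj i hi j hj h := natCast_injective_of_lt (N := K) (by omega) (by omega)
    (by simpa using congrArg Prod.fst h)
  attached i hi := by
    have hv : ((i : ℕ) : ZMod K).val < m := by rwa [ZMod.val_natCast_of_lt (by omega)]
    rcases ha' with h | h
    · refine ⟨v₀ + ((i : ZMod K), a) + (0, 1), mem_rect.2 ?_, Or.inr (Or.inr (Or.inl rfl))⟩
      simpa [add_assoc, -ZMod.val_natCast] using ⟨hv, h⟩
    · refine ⟨v₀ + ((i : ZMod K), a) - (0, 1), mem_rect.2 ?_, Or.inr (Or.inr (Or.inr rfl))⟩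
      simpa [add_sub_assoc, -ZMod.val_natCast] using ⟨hv, h⟩
  next i _ := Or.inr (Or.inl (Prod.ext (by simp; ring) (by simp)))

theorem mem_rect_withBar_row {a : ZMod K} (hn : n ≤ L) {v : Vertex K L} :
    v ∈ withBar (rect v₀ m n) (fun i => v₀ + (a, (i : ZMod L))) 0 n ↔
      ((v.1 - v₀.1).val < m ∨ v.1 = v₀.1 + a) ∧ (v.2 - v₀.2).val < n := by
  rw [mem_withBar, mem_rect, or_and_right, val_sub_lt_iff_exists hn]
  refine or_congr_right ⟨?_, ?_⟩
  · rintro ⟨i, hi, rfl⟩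
    exact ⟨rfl, i, hi.2, rfl⟩
  · rintro ⟨h, i, hi, h'⟩
    exact ⟨i, ⟨Nat.zero_le i, hi⟩, Prod.ext h.symm h'⟩

theorem mem_rect_withBar_col {a : ZMod L} (hm : m ≤ K) {v : Vertex K L} :
    v ∈ withBar (rect v₀ m n) (fun i => v₀ + ((i : ZMod K), a)) 0 m ↔
      (v.1 - v₀.1).val < m ∧ ((v.2 - v₀.2).val < n ∨ v.2 = v₀.2 + a) := by
  rw [mem_withBar, mem_rect, and_or_left, val_sub_lt_iff_exists hm]
  refine or_congr_right ⟨?_, ?_⟩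
  · rintro ⟨i, hi, rfl⟩
    exact ⟨⟨i, hi.2, rfl⟩, rfl⟩
  · rintro ⟨⟨i, hi, h'⟩, h⟩
    exact ⟨i, ⟨Nat.zero_le i, hi⟩, Prod.ext h' h.symm⟩

theorem withBar_top (hm : m < K) (hn : n ≤ L) :
    withBar (rect v₀ m n) (fun i => v₀ + ((m : ZMod K), (i : ZMod L))) 0 n =
      rect v₀ (m + 1) n := by
  ext v
  rw [mem_rect_withBar_row hn, mem_rect, val_sub_lt_succ_iff hm]

theorem withBar_bottom (hn : n ≤ L) :
    withBar (rect v₀ m n) (fun i => v₀ + ((-1 : ZMod K), (i : ZMod L))) 0 n =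
      rect (v₀ + (-1, 0)) (m + 1) n := by
  ext v
  rw [mem_rect_withBar_row hn, mem_rect, Prod.fst_add, Prod.snd_add, add_zero,
    val_sub_pred_lt_succ_iff]

theorem withBar_right (hm : m ≤ K) (hn : n < L) :
    withBar (rect v₀ m n) (fun i => v₀ + ((i : ZMod K), (n : ZMod L))) 0 m =
      rect v₀ m (n + 1) := by
  ext v
  rw [mem_rect_withBar_col hm, mem_rect, val_sub_lt_succ_iff hn]

theorem withBar_left (hm : m ≤ K) :
    withBar (rect v₀ m n) (fun i => v₀ + ((i : ZMod K), (-1 : ZMod L))) 0 m =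
      rect (v₀ + (0, -1)) m (n + 1) := by
  ext v
  rw [mem_rect_withBar_col hm, mem_rect, Prod.fst_add, Prod.snd_add, add_zero,
    val_sub_pred_lt_succ_iff]

/-- The residues `m` and, in `neg_one_isNext`, `-1` are those bordering the interval `0, …, m - 1`.
-/
theorem natCast_isNext {N m : ℕ} [NeZero N] (h1 : 1 ≤ m) (hm : m < N) :
    ¬ (m : ZMod N).val < m ∧ ((m : ZMod N) - 1).val < m := by
  constructor
  · rw [ZMod.val_natCast_of_lt hm]; omega
  · have : (m : ZMod N) - 1 = ((m - 1 : ℕ) : ZMod N) := by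
      rw [Nat.cast_sub h1, Nat.cast_one]
    rw [this, ZMod.val_natCast_of_lt (by omega)]
    omega

theorem neg_one_isNext {N m : ℕ} [NeZero N] (h1 : 1 ≤ m) (hm : m < N) :
    ¬ (-1 : ZMod N).val < m ∧ ((-1 : ZMod N) + 1).val < m := by
  have := val_neg_one_add_one (n := N)
  refine ⟨by omega, ?_⟩
  rw [neg_add_cancel, ZMod.val_zero]
  omega

theorem isSide_top (h1 : 1 ≤ m) (hm : m < K) (hn : n ≤ L) :
    IsSide (rect v₀ m n) n fun i => v₀ + ((m : ZMod K), (i : ZMod L)) :=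
  isSide_row (natCast_isNext h1 hm).1 (Or.inr (natCast_isNext h1 hm).2) hn

theorem isSide_bottom (h1 : 1 ≤ m) (hm : m < K) (hn : n ≤ L) :
    IsSide (rect v₀ m n) n fun i => v₀ + ((-1 : ZMod K), (i : ZMod L)) :=
  isSide_row (neg_one_isNext h1 hm).1 (Or.inl (neg_one_isNext h1 hm).2) hn

theorem isSide_right (h1 : 1 ≤ n) (hm : m ≤ K) (hn : n < L) :
    IsSide (rect v₀ m n) m fun i => v₀ + ((i : ZMod K), (n : ZMod L)) :=
  isSide_col (natCast_isNext h1 hn).1 (Or.inr (natCast_isNext h1 hn).2) hm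

theorem isSide_left (h1 : 1 ≤ n) (hm : m ≤ K) (hn : n < L) :
    IsSide (rect v₀ m n) m fun i => v₀ + ((i : ZMod K), (-1 : ZMod L)) :=
  isSide_col (neg_one_isNext h1 hn).1 (Or.inl (neg_one_isNext h1 hn).2) hm

theorem rect_one_one : rect v₀ 1 1 = {v₀} := by
  ext v
  simp [rect, ZMod.val_eq_zero, sub_eq_zero, Prod.ext_iff]

theorem rect_univ : rect v₀ K L = Finset.univ := by
  ext v
  simp [mem_rect, ZMod.val_lt]

/-- Each added side costs at most `2`. Only an upper bound holds in general, since a rectangle may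
wrap round the torus. -/
theorem perimeter_rect_le (hK : 3 ≤ K) (hL : 3 ≤ L) (v₀ : Vertex K L) (hm : 1 ≤ m) (hmK : m ≤ K)
    (hn : 1 ≤ n) (hnL : n ≤ L) :
    perimeter (rect v₀ m n) ≤ 2 * (m + n) ∧ (rect v₀ m n).card = m * n := by
  induction m, hm using Nat.le_induction with
  | base =>
    induction n, hn using Nat.le_induction with
    | base =>
      rw [rect_one_one]
      have h := perimeter_insert_le hK hL (Finset.notMem_empty v₀)
      rw [perimeter_empty, insert_empty_eq] at h
      exact ⟨by omega, Finset.card_singleton _⟩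
    | succ n hn ih =>
      obtain ⟨ih1, ih2⟩ := ih (by omega)
      have hs := isSide_right (v₀ := v₀) hn hmK (by omega : n < L)
      have h1 := hs.perimeter_withBar_le hK hL one_pos le_rfl
      have h2 := hs.card_withBar (i := 0) le_rfl
      rw [withBar_right hmK (by omega)] at h1 h2
      constructor
      · omega
      · rw [h2, ih2]; ring
  | succ m hm ih =>
    obtain ⟨ih1, ih2⟩ := ih (by omega)
    have hs := isSide_top (v₀ := v₀) hm (by omega : m < K) hnL
    have h1 := hs.perimeter_withBar_le hK hL (by omega : 0 < n) le_rfl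
    have h2 := hs.card_withBar (i := 0) le_rfl
    rw [withBar_top (by omega) hnL] at h1 h2
    constructor
    · omega
    · rw [h2, ih2, Nat.sub_zero]; ring

variable {g θ : ℝ}

/-- The energy bound is largest at the first vertex of the new side, which is the case `hθ`
controls. -/
theorem grows_top (hK : 3 ≤ K) (hL : 3 ≤ L) (hg : 0 ≤ g) (hm : 1 ≤ m) (hmK : m < K)
    (hn : 1 ≤ n) (hnL : n ≤ L) (hθ : (2 * (m + n) + 2 : ℝ) - g * (m * n + 1) < θ) :
    Grows g θ (rect v₀ m n) (rect v₀ (m + 1) n) := by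
  obtain ⟨h1, h2⟩ := perimeter_rect_le hK hL v₀ hm hmK.le hn hnL
  have hs := isSide_top (v₀ := v₀) hm hmK hnL
  have h1' : (perimeter (rect v₀ m n) : ℝ) ≤ 2 * (m + n) := by exact_mod_cast h1
  have := hs.grows_withBar (g := g) (θ := θ) (i := 0) (j := 0) hK hL hg le_rfl le_rfl
    (Nat.zero_le n) le_rfl (by rw [h2]; push_cast; linarith)
  rwa [withBar_self, withBar_top hmK hnL] at this

theorem grows_right (hK : 3 ≤ K) (hL : 3 ≤ L) (hg : 0 ≤ g) (hm : 1 ≤ m) (hmK : m ≤ K)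
    (hn : 1 ≤ n) (hnL : n < L) (hθ : (2 * (m + n) + 2 : ℝ) - g * (m * n + 1) < θ) :
    Grows g θ (rect v₀ m n) (rect v₀ m (n + 1)) := by
  obtain ⟨h1, h2⟩ := perimeter_rect_le hK hL v₀ hm hmK hn hnL.le
  have hs := isSide_right (v₀ := v₀) hn hmK hnL
  have h1' : (perimeter (rect v₀ m n) : ℝ) ≤ 2 * (m + n) := by exact_mod_cast h1
  have := hs.grows_withBar (g := g) (θ := θ) (i := 0) (j := 0) hK hL hg le_rfl le_rfl
    (Nat.zero_le m) le_rfl (by rw [h2]; push_cast; linarith)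
  rwa [withBar_self, withBar_right hmK hnL] at this

theorem grows_rows (hK : 3 ≤ K) (hL : 3 ≤ L) (hg : 0 ≤ g) {m' : ℕ} (hm : 1 ≤ m) (hmm : m ≤ m')
    (hmK : m' ≤ K) (hn : 1 ≤ n) (hnL : n ≤ L)
    (hθ : ∀ i : ℕ, m ≤ i → i < m' → (2 * (i + n) + 2 : ℝ) - g * (i * n + 1) < θ) :
    Grows g θ (rect v₀ m n) (rect v₀ m' n) := by
  induction m', hmm using Nat.le_induction with
  | base => exact Relation.ReflTransGen.refl
  | succ m' hmm ih =>
    exact (ih (by omega) fun i h1 h2 => hθ i h1 (by omega)).trans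
      (grows_top hK hL hg (by omega) (by omega) hn hnL (hθ m' hmm (by omega)))

theorem grows_cols (hK : 3 ≤ K) (hL : 3 ≤ L) (hg : 0 ≤ g) {n' : ℕ} (hm : 1 ≤ m) (hmK : m ≤ K)
    (hn : 1 ≤ n) (hnn : n ≤ n') (hnL : n' ≤ L)
    (hθ : ∀ i : ℕ, n ≤ i → i < n' → (2 * (m + i) + 2 : ℝ) - g * (m * i + 1) < θ) :
    Grows g θ (rect v₀ m n) (rect v₀ m n') := by
  induction n', hnn using Nat.le_induction with
  | base => exact Relation.ReflTransGen.refl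
  | succ n' hnn ih =>
    exact (ih (by omega) fun i h1 h2 => hθ i h1 (by omega)).trans
      (grows_right hK hL hg hm hmK (by omega) (by omega) (hθ n' hnn (by omega)))

theorem grows_empty (hK : 3 ≤ K) (hL : 3 ≤ L) (v₀ : Vertex K L) (hθ : 4 - g < θ) :
    Grows g θ ∅ (rect v₀ 1 1) := by
  have h1 := (perimeter_rect_le hK hL v₀ le_rfl (by omega) le_rfl (by omega : 1 ≤ L)).1
  have h1' : (perimeter (rect v₀ 1 1) : ℝ) ≤ 4 := by exact_mod_cast h1
  refine Relation.ReflTransGen.single ⟨?_, v₀, Finset.notMem_empty _, ?_⟩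
  · rw [rect_one_one] at h1' ⊢
    rw [Finset.card_singleton]
    push_cast
    linarith
  · rw [rect_one_one, insert_empty_eq]

end Rectangles

/-! ### Paths through the critical droplets -/

section Numerics

variable {k : ℕ} {h : ℝ}

/-- The difference of the two sides is `(k + 1 - j) * (2 - h * k)`. -/
theorem rect_energy_lt_of_side (hk : h * k < 2) {j : ℕ} (hj : j ≤ k) :
    (2 * (k + j) + 2 : ℝ) - h * (k * j + 1) < 4 * (k + 1) - h * (k * (k + 1) + 1) := by
  have : (j : ℝ) ≤ k := by exact_mod_cast hj
  nlinarith [mul_nonneg (sub_nonneg.2 this) (sub_nonneg.2 hk.le)]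

/-- The left side increases with `j`, and at `j = k` it is that of `rect_energy_lt_of_side` with `j
= 1`. The case `j = 0` is a single vertex. -/
theorem strip_energy_lt (h_lt : h < 1) (hk1 : 1 ≤ k) (hk : h * k < 2) {j : ℕ} (hj : j ≤ k) :
    (2 * (j + 1) + 2 : ℝ) - h * (j * 1 + 1) < 4 * (k + 1) - h * (k * (k + 1) + 1) := by
  have h1 := rect_energy_lt_of_side hk hk1
  push_cast at h1
  have : (j : ℝ) ≤ k := by exact_mod_cast hj
  nlinarith [mul_nonneg (sub_nonneg.2 this) (sub_nonneg.2 h_lt.le)]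

/-- For `m = k + 1 + a` and `n = k + 1 + b` the difference is `(h * (k + 1) - 2) * (1 + a + b) + h *
a * b`. -/
theorem rect_energy_lt_of_le (h_pos : 0 < h) (hk : 2 < h * (k + 1)) {m n : ℕ} (hm : k + 1 ≤ m)
    (hn : k + 1 ≤ n) :
    (2 * (m + n) + 2 : ℝ) - h * (m * n + 1) < 4 * (k + 1) - h * (k * (k + 1) + 1) := by
  have hm' : (0 : ℝ) ≤ m - (k + 1) := by
    rw [sub_nonneg]; exact_mod_cast hm
  have hn' : (0 : ℝ) ≤ n - (k + 1) := by
    rw [sub_nonneg]; exact_mod_cast hn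
  have h1 := mul_nonneg h_pos.le (mul_nonneg hm' hn')
  have h2 := mul_nonneg hm' (sub_nonneg.2 hk.le)
  have h3 := mul_nonneg hn' (sub_nonneg.2 hk.le)
  nlinarith

end Numerics

section Droplets

variable [NeZero K] [NeZero L] {k : ℕ} {h : ℝ} {v₀ : Vertex K L}

theorem grows_empty_rect_of_rows (h_pos : 0 < h) (h_lt : h < 1) (hk1 : 1 ≤ k) (hk : h * k < 2)
    (hK : 3 * (k + 1) ≤ K) (hL : 3 * (k + 1) ≤ L) :
    Grows h (4 * (k + 1) - h * (k * (k + 1) + 1)) ∅ (rect v₀ k (k + 1)) := by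
  have h0 := strip_energy_lt h_lt hk1 hk (Nat.zero_le k)
  push_cast at h0
  refine ((grows_empty (by omega) (by omega) v₀ (by linarith)).trans
    (grows_rows (m' := k) (by omega) (by omega) h_pos.le le_rfl hk1 (by omega) le_rfl (by omega)
      fun i _ hi => ?_)).trans
    (grows_cols (n' := k + 1) (by omega) (by omega) h_pos.le hk1 (by omega) le_rfl (by omega)
      (by omega) fun i _ hi => rect_energy_lt_of_side hk (by omega))
  simpa using strip_energy_lt h_lt hk1 hk hi.le

theorem grows_empty_rect_of_cols (h_pos : 0 < h) (h_lt : h < 1) (hk1 : 1 ≤ k) (hk : h * k < 2)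
    (hK : 3 * (k + 1) ≤ K) (hL : 3 * (k + 1) ≤ L) :
    Grows h (4 * (k + 1) - h * (k * (k + 1) + 1)) ∅ (rect v₀ (k + 1) k) := by
  have h0 := strip_energy_lt h_lt hk1 hk (Nat.zero_le k)
  push_cast at h0
  refine ((grows_empty (by omega) (by omega) v₀ (by linarith)).trans
    (grows_cols (n' := k) (by omega) (by omega) h_pos.le le_rfl (by omega) le_rfl hk1 (by omega)
      fun i _ hi => ?_)).trans
    (grows_rows (m' := k + 1) (by omega) (by omega) h_pos.le le_rfl (by omega) (by omega) hk1
      (by omega) fun i _ hi => ?_)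
  · have := strip_energy_lt h_lt hk1 hk hi.le
    push_cast
    linarith
  · have := rect_energy_lt_of_side hk (j := i) (by omega)
    linarith

theorem grows_square_univ (h_pos : 0 < h) (hk : 2 < h * (k + 1))
    (hK : 3 * (k + 1) ≤ K) (hL : 3 * (k + 1) ≤ L) :
    Grows h (4 * (k + 1) - h * (k * (k + 1) + 1)) (rect v₀ (k + 1) (k + 1)) Finset.univ := by
  rw [← rect_univ (v₀ := v₀)]
  exact (grows_cols (n' := L) (by omega) (by omega) h_pos.le (by omega) (by omega) (by omega)
      (by omega) le_rfl fun i hi _ => rect_energy_lt_of_le h_pos hk le_rfl hi).trans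
    (grows_rows (m' := K) (by omega) (by omega) h_pos.le (by omega) (by omega) le_rfl (by omega)
      le_rfl fun i hi _ => rect_energy_lt_of_le h_pos hk hi (by omega))

/-- Without field, a droplet can grow to the whole torus below the level `2 (K + L) + 2`. -/
theorem grows_univ_of_lt {θ : ℝ} (hK : 3 ≤ K) (hL : 3 ≤ L) (hθ : (2 * (K + L) + 2 : ℝ) < θ) :
    Grows 0 θ (∅ : Finset (Vertex K L)) Finset.univ := by
  rw [← rect_univ (v₀ := 0)]
  have hbound : ∀ m n : ℕ, m ≤ K → n ≤ L → (2 * (m + n) + 2 : ℝ) - 0 * (m * n + 1) < θ := by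
    intro m n hm hn
    have hm' : (m : ℝ) ≤ K := by exact_mod_cast hm
    have hn' : (n : ℝ) ≤ L := by exact_mod_cast hn
    linarith
  have h0 : (4 : ℝ) - 0 < θ := by
    have := hbound 1 1 (by omega) (by omega)
    push_cast at this
    linarith
  exact ((grows_empty hK hL 0 h0).trans
    (grows_rows hK hL le_rfl le_rfl (by omega) le_rfl le_rfl (by omega)
      fun i _ hi => hbound i 1 hi.le (by omega))).trans
    (grows_cols hK hL le_rfl (by omega) le_rfl le_rfl (by omega) le_rfl
      fun i _ hi => hbound K i le_rfl hi.le)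

/-- A quasi-square with a protuberance is a `k × (k + 1)` rectangle `R` with a vertex of one of
its longest sides; `R` is reached from below, and the completion of the side leads to the whole
torus. -/
theorem exists_side_of_mem_rectanglesWithBar (h_pos : 0 < h) (h_lt : h < 1) (hk1 : 1 ≤ k)
    (hk : h * k < 2) (hk' : 2 < h * (k + 1)) (hK : 3 * (k + 1) ≤ K) (hL : 3 * (k + 1) ≤ L)
    {S : Set (Vertex K L)} (hS : S ∈ rectanglesWithBar K L k (k + 1) 1) :
    ∃ (R : Finset (Vertex K L)) (f : ℕ → Vertex K L) (c : ℕ), c < k + 1 ∧ IsSide R (k + 1) f ∧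
      (∀ v, v ∈ withBar R f c (c + 1) ↔ v ∈ S) ∧ perimeter R ≤ 2 * (2 * k + 1) ∧
      R.card = k * (k + 1) ∧ Grows h (4 * (k + 1) - h * (k * (k + 1) + 1)) ∅ R ∧
      Grows h (4 * (k + 1) - h * (k * (k + 1) + 1)) (withBar R f 0 (k + 1)) Finset.univ := by
  obtain ⟨v₀, c, hc, hS⟩ := hS
  have hmem : ∀ (R : Finset (Vertex K L)) (f : ℕ → Vertex K L) (v : Vertex K L),
      v ∈ withBar R f c (c + 1) ↔ v ∈ (R : Set (Vertex K L)) ∪ rectangle (f c) 1 1 := by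
    intro R f v
    rw [withBar_succ le_rfl, withBar_self, Finset.mem_insert, Set.mem_union,
      mem_rectangle_one_one, Finset.mem_coe, or_comm]
  have hrow := perimeter_rect_le (by omega) (by omega) v₀ hk1 (by omega : k ≤ K)
    (by omega : 1 ≤ k + 1) (by omega : k + 1 ≤ L)
  have hcol := perimeter_rect_le (by omega) (by omega) v₀ (by omega : 1 ≤ k + 1)
    (by omega : k + 1 ≤ K) hk1 (by omega : k ≤ L)
  have hgrow := grows_empty_rect_of_rows (v₀ := v₀) h_pos h_lt hk1 hk hK hL
  have hgcol := grows_empty_rect_of_cols (v₀ := v₀) h_pos h_lt hk1 hk hK hL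
  rcases hS with rfl | rfl | rfl | rfl
  · refine ⟨rect v₀ k (k + 1), fun i => v₀ + ((k : ZMod K), (i : ZMod L)), c, by omega,
      isSide_top hk1 (by omega) (by omega), fun v => ?_, by omega, hrow.2, hgrow, ?_⟩
    · rw [hmem, coe_rect]
    · rw [withBar_top (by omega) (by omega)]
      exact grows_square_univ h_pos hk' hK hL
  · refine ⟨rect v₀ k (k + 1), fun i => v₀ + ((-1 : ZMod K), (i : ZMod L)), c, by omega,
      isSide_bottom hk1 (by omega) (by omega), fun v => ?_, by omega, hrow.2, hgrow, ?_⟩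
    · rw [hmem, coe_rect]
    · rw [withBar_bottom (by omega)]
      exact grows_square_univ h_pos hk' hK hL
  · refine ⟨rect v₀ (k + 1) k, fun i => v₀ + ((i : ZMod K), (k : ZMod L)), c, by omega,
      isSide_right hk1 (by omega) (by omega), fun v => ?_, by omega, by rw [hcol.2, mul_comm],
      hgcol, ?_⟩
    · rw [hmem, coe_rect]
    · rw [withBar_right (by omega) (by omega)]
      exact grows_square_univ h_pos hk' hK hL
  · refine ⟨rect v₀ (k + 1) k, fun i => v₀ + ((i : ZMod K), (-1 : ZMod L)), c, by omega,
      isSide_left hk1 (by omega) (by omega), fun v => ?_, by omega, by rw [hcol.2, mul_comm],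
      hgcol, ?_⟩
    · rw [hmem, coe_rect]
    · rw [withBar_left (by omega)]
      exact grows_square_univ h_pos hk' hK hL

end Droplets

/-! ### From droplets to configurations -/

section Painting

/-- The configuration with the spin `c` in `R` and the spin `r` outside. -/
def paint (r c : Spin q) (R : Finset (Vertex K L)) : Config K L q :=
  fun v => if v ∈ R then c else r

variable {r c : Spin q} {R : Finset (Vertex K L)}

theorem paint_insert (v : Vertex K L) :
    paint r c (insert v R) = Function.update (paint r c R) v c := by
  funext w
  by_cases hw : w = v
  · subst hw; simp [paint]
  · simp [paint, hw]

variable [NeZero K] [NeZero L]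

theorem wall_paint (hrc : r ≠ c) : wall (paint r c R) = perimeter R := by
  have hiff : ∀ v w : Vertex K L, paint r c R v ≠ paint r c R w ↔
      decide (v ∈ R) ≠ decide (w ∈ R) := by
    intro v w
    by_cases hv : v ∈ R <;> by_cases hw : w ∈ R <;> simp [paint, hv, hw, hrc, hrc.symm]
  simp only [perimeter, wall, disagreements, hiff]

variable [NeZero q]

theorem energy_paint_spinOne (hK : 3 ≤ K) (hL : 3 ≤ L) (h : ℝ) (hc : c ≠ spinOne q) :
    energy h (paint (spinOne q) c R) =
      -2 * (K * L) + h * (K * L) + (perimeter R - h * R.card) := by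
  have : nonOne (paint (spinOne q) c R) = R := by
    ext v
    by_cases hv : v ∈ R <;> simp [mem_nonOne, paint, hv, hc]
  rw [energy_eq hK hL, wall_paint hc.symm, this]
  ring

theorem energy_paint_of_ne (hK : 3 ≤ K) (hL : 3 ≤ L) (h : ℝ) (hr : r ≠ spinOne q)
    (hc : c ≠ spinOne q) (hrc : r ≠ c) :
    energy h (paint r c R) = -2 * (K * L) + perimeter R := by
  have : nonOne (paint r c R) = Finset.univ := by
    ext v
    by_cases hv : v ∈ R <;> simp [mem_nonOne, paint, hv, hc, hr]
  rw [energy_eq hK hL, wall_paint hrc, this, Finset.card_univ, Fintype.card_prod, ZMod.card,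
    ZMod.card]
  push_cast
  ring

/-- Growing droplets give moves between painted configurations. -/
theorem reflTransGen_paint {g θ : ℝ} {R' : Finset (Vertex K L)} {P : Config K L q → Prop}
    (hrc : r ≠ c) (hP : ∀ R : Finset (Vertex K L), (perimeter R : ℝ) - g * R.card < θ →
      P (paint r c R)) (hR : Grows g θ R R') :
    Relation.ReflTransGen (fun σ σ' => 0 < connectivity σ σ' ∧ P σ') (paint r c R)
      (paint r c R') := by
  refine Relation.ReflTransGen.lift (paint r c) (fun S S' hS => ?_) _ _ hR
  obtain ⟨hlt, v, hv, rfl⟩ := hS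
  refine ⟨?_, hP _ hlt⟩
  rw [paint_insert]
  exact connectivity_update_pos (by simpa [paint, hv] using hrc)

end Painting

section Main

theorem criticalSet_nonempty [NeZero q] {k : ℕ} {h : ℝ} (hq : 1 < q)
    (hcrit : criticalLength h = k + 1) :
    (criticalSet K L q h).Nonempty := by
  classical
  let two : Spin q := ⟨2, Finset.mem_Icc.2 ⟨by norm_num, hq⟩⟩
  have htwo : two ≠ spinOne q := by simp [two, spinOne]
  let S : Set (Vertex K L) := rectangle 0 k (k + 1) ∪
    rectangle (0 + ((k : ZMod K), ((0 : ℕ) : ZMod L))) 1 1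
  refine ⟨fun v => if v ∈ S then two else spinOne q, Set.mem_biUnion (x := two) htwo ?_⟩
  rw [hcrit, Nat.add_sub_cancel]
  exact ⟨S, ⟨0, 0, by omega, Or.inl rfl⟩, fun v => ⟨fun hv => if_pos hv, fun hv => if_neg hv⟩⟩

variable [NeZero K] [NeZero L] [NeZero q] {k : ℕ} {h : ℝ}

/-- Every critical configuration has the critical energy, and it is the only configuration of at
least this energy on some path from `1` to the given stable state. -/
theorem exists_path_through (hq : 1 < q) (hcrit : criticalLength h = k + 1) (hk2 : 2 ≤ k)
    (h_pos : 0 < h) (h_lt : h < 1) (hk : h * k < 2) (hk' : 2 < h * (k + 1))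
    (hK : 3 * (k + 1) ≤ K) (hL : 3 * (k + 1) ≤ L) {s : Config K L q}
    (hs : s ∈ EnergyLandscape.stableStates (energy h)) {w : Config K L q}
    (hw : w ∈ criticalSet K L q h) :
    energy h w = saddleEnergy K L k h ∧
      ∃ ω ∈ EnergyLandscape.paths connectivity (allOne K L q) {s}, w ∈ ω ∧
        ∀ x ∈ ω, x ≠ w → energy h x < saddleEnergy K L k h := by
  have hK3 : 3 ≤ K := by omega
  have hL3 : 3 ≤ L := by omega
  obtain ⟨a, ha, rfl⟩ := exists_eq_const_of_mem_stableStates hq h_pos hK3 hL3 hs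
  simp only [criticalSet, Set.mem_iUnion, hcrit, Nat.add_sub_cancel] at hw
  obtain ⟨t, ht, S, hS, hwS⟩ := hw
  replace ht : t ≠ spinOne q := ht
  obtain ⟨R, f, c, hc, hside, hRS, hper, hcard, hgrow, hgrow'⟩ :=
    exists_side_of_mem_rectanglesWithBar h_pos h_lt (by omega) hk hk' hK hL hS
  have hwpaint : w = paint (spinOne q) t (withBar R f c (c + 1)) := by
    funext v
    by_cases hv : v ∈ withBar R f c (c + 1)
    · simp [paint, hv, (hwS v).1 ((hRS v).1 hv)]
    · simp [paint, hv, (hwS v).2 fun h => hv ((hRS v).2 h)]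
  have hcardbar : (withBar R f c (c + 1)).card = k * (k + 1) + 1 := by
    rw [hside.card_withBar (by omega), hcard]; omega
  -- The construction gives the upper bound, the isoperimetric inequality the lower one.
  have hperbar : perimeter (withBar R f c (c + 1)) = 4 * (k + 1) := by
    refine le_antisymm ?_ ?_
    · have := hside.perimeter_withBar_le hK3 hL3 (Nat.lt_add_one c) hc
      omega
    · have hA : nonOne w = withBar R f c (c + 1) := by
        ext v
        rw [hwpaint]
        by_cases hv : v ∈ withBar R f c (c + 1) <;> simp [mem_nonOne, paint, hv, ht]
      have h1 := two_mul_le_halfPerimeter (k := k) hK hL (A := withBar R f c (c + 1))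
        (by rw [hcardbar]; nlinarith) (by omega)
      have h2 := wall_eq w
      have h3 := wall_paint (R := withBar R f c (c + 1)) ht.symm
      rw [← hwpaint] at h3
      rw [hA] at h2
      omega
  have hE : energy h w = saddleEnergy K L k h := by
    rw [hwpaint, energy_paint_spinOne hK3 hL3 h ht, hperbar, hcardbar, saddleEnergy]
    push_cast
    ring
  refine ⟨hE, ?_⟩
  let P : Config K L q → Prop := fun x => x ≠ w → energy h x < saddleEnergy K L k h
  have hPt : ∀ S : Finset (Vertex K L),
      (perimeter S : ℝ) - h * S.card < 4 * (k + 1) - h * (k * (k + 1) + 1) →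
      P (paint (spinOne q) t S) := by
    intro S hS _
    rw [energy_paint_spinOne hK3 hL3 h ht, saddleEnergy]
    linarith
  have hone : paint (spinOne q) t ∅ = allOne K L q := by
    funext v; simp [paint, allOne]
  have hfull : ∀ r c : Spin q, paint r c (Finset.univ : Finset (Vertex K L)) = fun _ => c := by
    intro r c; funext v; simp [paint]
  have hto : Relation.ReflTransGen (fun σ σ' => 0 < connectivity σ σ' ∧ P σ') (allOne K L q) w := by
    have h1 := reflTransGen_paint ht.symm hPt hgrow
    rw [hone] at h1
    refine h1.tail ⟨?_, fun hne => absurd rfl hne⟩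
    rw [hwpaint, withBar_succ le_rfl, withBar_self, paint_insert]
    exact connectivity_update_pos (by simpa [paint, hside.notMem c hc] using ht.symm)
  have hcomplete : Grows h (4 * (k + 1) - h * (k * (k + 1) + 1)) (withBar R f c (c + 1))
      (withBar R f 0 (k + 1)) := by
    -- From its second vertex on, the bar gains another `h` at no cost in perimeter, so the energy
    -- is strictly below the critical one.
    refine hside.grows_withBar hK3 hL3 h_pos.le (Nat.zero_le c) (Nat.le_succ c) hc le_rfl ?_
    have hper' : (perimeter R : ℝ) ≤ 2 * (2 * k + 1) := by exact_mod_cast hper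
    rw [hcard, Nat.succ_sub (le_refl c), Nat.sub_self]
    push_cast
    linarith
  have hfrom : Relation.ReflTransGen (fun σ σ' => 0 < connectivity σ σ' ∧ P σ') w fun _ => t := by
    have h1 := reflTransGen_paint ht.symm hPt (hcomplete.trans hgrow')
    rwa [← hwpaint, hfull] at h1
  -- Both spins differ from `1`, so the field does not distinguish them and the droplet of `a` grows
  -- with `g = 0`.
  have hswitch : Relation.ReflTransGen (fun σ σ' : Config K L q => 0 < connectivity σ σ' ∧ P σ')
      (fun _ => t) fun _ => a := by
    by_cases hta : t = a
    · rw [hta]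
    · have hempty : paint t a (∅ : Finset (Vertex K L)) = fun _ => t := by
        funext v; simp [paint]
      -- From `h * (k + 1) > 2` both `h * K` and `h * L` are at least `6`, so `h * K * L ≥ 3 * (K +
      -- L)`; the other summand exceeds `4 - h > 3`.
      have hθ : (2 * (K + L) + 2 : ℝ) <
          h * (K * L) + (4 * (k + 1) - h * (k * (k + 1) + 1)) := by
        have h0 := strip_energy_lt h_lt (by omega : 1 ≤ k) hk (Nat.zero_le k)
        push_cast at h0
        have hKr : (3 * (k + 1) : ℝ) ≤ K := by exact_mod_cast hK
        have hLr : (3 * (k + 1) : ℝ) ≤ L := by exact_mod_cast hL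
        have hK6 : 6 ≤ h * K := by nlinarith [mul_le_mul_of_nonneg_left hKr h_pos.le]
        have hL6 : 6 ≤ h * L := by nlinarith [mul_le_mul_of_nonneg_left hLr h_pos.le]
        have hK3r : (3 : ℝ) ≤ K := by exact_mod_cast hK3
        have hL3r : (3 : ℝ) ≤ L := by exact_mod_cast hL3
        have h1 : 6 * (L : ℝ) ≤ h * K * L := mul_le_mul_of_nonneg_right hK6 (by linarith)
        have h2 : 6 * (K : ℝ) ≤ h * L * K := mul_le_mul_of_nonneg_right hL6 (by linarith)
        nlinarith
      have h1 := reflTransGen_paint (P := P) hta (fun S hS _ => by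
        rw [energy_paint_of_ne hK3 hL3 h ht ha hta, saddleEnergy]
        linarith) (grows_univ_of_lt hK3 hL3 hθ)
      rwa [hempty, hfull] at h1
  -- The path is prolonged in two stages, so that `w`, the end of the first, is known to lie on the
  -- final path.
  obtain ⟨ω, hω1, hω2, -, hω4⟩ := EnergyLandscape.exists_path_extension
    (RelSeries.singleton _ (allOne K L q)) (b := w) (P := P) (by simpa using hto)
  obtain ⟨ω', hω'1, hω'2, hω'3, hω'4⟩ := EnergyLandscape.exists_path_extension ω
    (b := fun _ => a) (P := P) (by rw [hω2]; exact hfrom.trans hswitch)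
  refine ⟨ω', ⟨by rw [hω'1, hω1]; simp, hω'2⟩, hω'3 w (hω2 ▸ ω.last_mem), fun x hx hxw => ?_⟩
  rcases hω'4 x hx with hx | hx
  · rcases hω4 x hx with hx | hx
    · obtain ⟨i, rfl⟩ := hx
      have h4 := strip_energy_lt h_lt (by omega : 1 ≤ k) hk (Nat.zero_le k)
      push_cast at h4
      have h5 := hPt ∅ (by rw [perimeter_empty, Finset.card_empty]; push_cast; linarith)
      rw [hone] at h5
      exact h5 hxw
    · exact hx hxw
  · exact hx hxw

end Main

end Potts

/-! ### The theorem -/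

theorem theorem4p10 (K L q : ℕ) [NeZero K] [NeZero L] [NeZero q] (hq : 2 < q)
    (h : ℝ) (h_pos : 0 < h) (h_lt : h < 1) (h_int : ∀ n : ℤ, 2 / h ≠ n)
    (hK : 3 * Potts.criticalLength h ≤ K) (hL : 3 * Potts.criticalLength h ≤ L)
    (s : Potts.Config K L q)
    (hs : s ∈ EnergyLandscape.stableStates (Potts.energy (K := K) (L := L) (q := q) h)) :
    EnergyLandscape.IsMinimalGate (Potts.energy h) Potts.connectivity
      (Potts.allOne K L q) {s} (Potts.criticalSet K L q h) ∧
    EnergyLandscape.gateUnion (Potts.energy h) Potts.connectivity (Potts.allOne K L q) {s} =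
      EnergyLandscape.gateUnion (Potts.energy h) Potts.connectivity (Potts.allOne K L q)
        (EnergyLandscape.stableStates (Potts.energy h)) := by
  obtain ⟨k, hcrit, hk2, hk, hk'⟩ := Potts.exists_criticalLength_eq h_pos h_lt h_int
  rw [hcrit] at hK hL
  have hthrough := fun (w : Potts.Config K L q) (hw : w ∈ Potts.criticalSet K L q h) =>
    Potts.exists_path_through (by omega) hcrit hk2 h_pos h_lt hk hk' hK hL hs hw
  -- The gate does not depend on the target: every set of stable states containing `s` yields the
  -- critical set, since a path to `s` is also a path to `A`.
  have hgate : ∀ A : Set (Potts.Config K L q), s ∈ A →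
      A ⊆ EnergyLandscape.stableStates (Potts.energy h) →
      EnergyLandscape.IsMinimalGate (Potts.energy h) Potts.connectivity (Potts.allOne K L q) A
        (Potts.criticalSet K L q h) ∧
      EnergyLandscape.gateUnion (Potts.energy h) Potts.connectivity (Potts.allOne K L q) A =
        Potts.criticalSet K L q h := by
    intro A hsA hA
    refine EnergyLandscape.isMinimalGate_and_gateUnion_eq
      (Γ := Potts.saddleEnergy K L k h)
      (Potts.criticalSet_nonempty (by omega) hcrit)
      (fun ω hω hheight => Potts.visits_criticalSet (by omega) hcrit hk2 h_pos hk hK hL hA ω hω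
        hheight) (fun w hw => (hthrough w hw).1) fun w hw => ?_
    obtain ⟨-, ω, ⟨hω1, hω2⟩, hω3⟩ := hthrough w hw
    refine ⟨ω, ⟨hω1, ?_⟩, hω3⟩
    rw [Set.mem_singleton_iff.1 hω2]
    exact hsA
  obtain ⟨h1, h2⟩ := hgate {s} rfl (Set.singleton_subset_iff.2 hs)
  exact ⟨h1, h2.trans (hgate _ hs subset_rfl).2.symm⟩
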